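/- Let $\mathbb D=\{w\in\mathbb C:|w|\le 1\}$ be the closed unit disc and let $\mathbf z_3\subset\mathbb D$ be a set of three distinct interior points. Let $\mathrm{Homeo}_\partial(\mathbb D,\mathbf z_3)$ be the group of homeomorphisms of $\mathbb D$ that fix $\partial\mathbb D$ pointwise and preserve $\mathbf z_3$ as a set (such homeomorphisms are automatically orientation preserving), and let $\mathrm{Diff}^\infty_\partial(\mathbb D,\mathbf z_3)$ be its subgroup of $C^\infty$ diffeomorphisms (smooth up to the boundary, with smooth inverse). Let $\mathrm{Mod}(\Sigma_{0,3}^1)=\pi_0\,\mathrm{Homeo}_\partial(\mathbb D,\mathbf z_3)$ be the mapping class group of the disc with three marked points, i.e. the group of these homeomorphisms modulo isotopy through elements of $\mathrm{Homeo}_\partial(\mathbb D,\mathbf z_3)$. Then: 1. the natural map $\pi:\mathrm{Diff}^\infty_\partial(\mathbb D,\mathbf z_3)\to\mathrm{Mod}(\Sigma_{0,3}^1)$, sending a diffeomorphism to its isotopy class, is surjective; 2. $\mathrm{Mod}(\Sigma_{0,3}^1)$ is isomorphic to the braid group $B_3=\langle\sigma_1,\sigma_2\mid\sigma_1\sigma_2\sigma_1=\sigma_2\sigma_1\sigma_2\rangle$;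 3. $\pi$ has a section: there is a group homomorphism $s:\mathrm{Mod}(\Sigma_{0,3}^1)\to\mathrm{Diff}^\infty_\partial(\mathbb D,\mathbf z_3)$ with $\pi\circ s=\mathrm{id}$. Hence the braid group $B_3$ is realized by smooth diffeomorphisms of the disc with three marked points. -/

import Mathlib

open scoped ContDiff

/-- The closed unit disc `𝔻 = {w ∈ ℂ : |w| ≤ 1}`, where `ℂ` is regarded as the Euclidean plane. -/
abbrev Disc : Type := Metric.closedBall (0 : ℂ) 1

/-- The set of marked points `{z 0, …, z (m - 1)}`, as a subset of the disc. -/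
def markedSet {m : ℕ} (z : Fin m → ℂ) : Set Disc := {x | (x : ℂ) ∈ Set.range z}

/-- The group `Homeo_∂(𝔻, z)` of homeomorphisms of the disc that fix the boundary circle pointwise
and preserve the set of marked points. Such a homeomorphism is automatically orientation
preserving, because it is the identity on the boundary circle. -/
def homeoBdry {m : ℕ} (z : Fin m → ℂ) : Subgroup (Disc ≃ₜ Disc) where
  carrier := {f | (∀ x : Disc, ‖(x : ℂ)‖ = 1 → f x = x) ∧
    ∀ x : Disc, f x ∈ markedSet z ↔ x ∈ markedSet z}
  one_mem' := ⟨fun _ _ => rfl, fun _ => Iff.rfl⟩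
  mul_mem' := by
    rintro f g ⟨hf, hf'⟩ ⟨hg, hg'⟩
    refine ⟨fun x hx => ?_, fun x => ?_⟩
    · change f (g x) = x
      rw [hg x hx, hf x hx]
    · exact (hf' (g x)).trans (hg' x)
  inv_mem' := by
    rintro f ⟨hf, hf'⟩
    refine ⟨fun x hx => ?_, fun x => ?_⟩
    · change f.symm x = x
      rw [Homeomorph.symm_apply_eq, hf x hx]
    · have h := hf' (f.symm x)
      rw [Homeomorph.apply_symm_apply] at h
      exact h.symm

/-- A self-map of the closed disc is smooth if it is `C^∞` up to the boundary, as a map between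
subsets of the plane. -/
def IsSmoothDisc (f : Disc → Disc) : Prop :=
  ∃ F : ℂ → ℂ, ContDiffOn ℝ ∞ F (Metric.closedBall (0 : ℂ) 1) ∧ ∀ x : Disc, F x = f x

lemma isSmoothDisc_id : IsSmoothDisc (fun x => x) :=
  ⟨fun w => w, contDiffOn_id, fun _ => rfl⟩

lemma IsSmoothDisc.comp {f g : Disc → Disc} (hf : IsSmoothDisc f) (hg : IsSmoothDisc g) :
    IsSmoothDisc (fun x => f (g x)) := by
  obtain ⟨F, hF, hFf⟩ := hf
  obtain ⟨G, hG, hGg⟩ := hg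
  refine ⟨fun w => F (G w), ContDiffOn.comp hF hG ?_, fun x => ?_⟩
  · intro w hw
    have h := hGg ⟨w, hw⟩
    change G w ∈ _
    change G w = _ at h
    rw [h]
    exact (g ⟨w, hw⟩).2
  · change F (G x) = _
    rw [hGg, hFf]

/-- The group `Diff^∞_∂(𝔻, z)`: the elements of `Homeo_∂(𝔻, z)` that are smooth and have a smooth
inverse, that is, the smooth diffeomorphisms of the disc that fix the boundary pointwise and
preserve the set of marked points. -/
def diffBdry {m : ℕ} (z : Fin m → ℂ) : Subgroup (homeoBdry z) where
  carrier := {f | IsSmoothDisc (f : Disc ≃ₜ Disc) ∧ IsSmoothDisc (f : Disc ≃ₜ Disc).symm}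
  one_mem' := ⟨isSmoothDisc_id, isSmoothDisc_id⟩
  mul_mem' := by
    rintro f g ⟨hf, hf'⟩ ⟨hg, hg'⟩
    exact ⟨hf.comp hg, hg'.comp hf'⟩
  inv_mem' := by
    rintro f ⟨hf, hf'⟩
    exact ⟨hf', hf⟩

/-- `f` and `g` are isotopic relative to the boundary and the marked points: they are joined by a
jointly continuous path `t ↦ H t` in `Homeo_∂(𝔻, z)`. -/
def Isotopic {m : ℕ} {z : Fin m → ℂ} (f g : homeoBdry z) : Prop :=
  ∃ H : unitInterval → homeoBdry z,
    Continuous (fun p : unitInterval × Disc => (H p.1 : Disc ≃ₜ Disc) p.2) ∧ H 0 = f ∧ H 1 = g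

lemma Isotopic.mul_left {m : ℕ} {z : Fin m → ℂ} {f g : homeoBdry z} (k : homeoBdry z)
    (h : Isotopic f g) : Isotopic (k * f) (k * g) := by
  obtain ⟨H, hH, h0, h1⟩ := h
  exact ⟨fun t => k * H t, (k : Disc ≃ₜ Disc).continuous.comp hH, by simp [h0], by simp [h1]⟩

lemma Isotopic.mul_right {m : ℕ} {z : Fin m → ℂ} {f g : homeoBdry z} (k : homeoBdry z)
    (h : Isotopic f g) : Isotopic (f * k) (g * k) := by
  obtain ⟨H, hH, h0, h1⟩ := h
  refine ⟨fun t => H t * k, ?_, by simp [h0], by simp [h1]⟩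
  exact hH.comp (continuous_fst.prodMk ((k : Disc ≃ₜ Disc).continuous.comp continuous_snd))

lemma Isotopic.symm {m : ℕ} {z : Fin m → ℂ} {f g : homeoBdry z} (h : Isotopic f g) :
    Isotopic g f := by
  obtain ⟨H, hH, h0, h1⟩ := h
  refine ⟨fun t => H (unitInterval.symm t), ?_, by simp [h1], by simp [h0]⟩
  exact hH.comp ((unitInterval.continuous_symm.comp continuous_fst).prodMk continuous_snd)

/-- The identity component of `Homeo_∂(𝔻, z)`: the homeomorphisms isotopic to the identity. -/
def isotopicToId {m : ℕ} (z : Fin m → ℂ) : Subgroup (homeoBdry z) where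
  carrier := {f | Isotopic 1 f}
  one_mem' := ⟨fun _ => 1, continuous_snd, rfl, rfl⟩
  mul_mem' := by
    rintro f g ⟨H, hH, h0, h1⟩ ⟨K, hK, k0, k1⟩
    refine ⟨fun t => H t * K t, ?_, by simp [h0, k0], by simp [h1, k1]⟩
    exact hH.comp (continuous_fst.prodMk hK)
  inv_mem' := by
    intro f hf
    have h := hf.symm.mul_right f⁻¹
    rwa [mul_inv_cancel, one_mul] at h

instance isotopicToId_normal {m : ℕ} (z : Fin m → ℂ) : (isotopicToId z).Normal where
  conj_mem := by
    intro f hf g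
    have h := (Isotopic.mul_left g hf).mul_right g⁻¹
    rwa [mul_one, mul_inv_cancel] at h

/-- The mapping class group `Mod(Σ_{0,m}^1) = π₀ Homeo_∂(𝔻, z)` of the disc with marked points:
homeomorphisms modulo isotopy relative to the boundary and the marked points. -/
abbrev MappingClassGroup {m : ℕ} (z : Fin m → ℂ) : Type := homeoBdry z ⧸ isotopicToId z

/-- Two homeomorphisms define the same mapping class exactly when they are isotopic. -/
lemma mappingClass_eq_iff {m : ℕ} {z : Fin m → ℂ} (f g : homeoBdry z) :
    (f : MappingClassGroup z) = (g : MappingClassGroup z) ↔ Isotopic f g := by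
  rw [QuotientGroup.eq]
  constructor
  · intro h
    have h' := Isotopic.mul_left f h
    rwa [mul_one, mul_inv_cancel_left] at h'
  · intro h
    have h' := Isotopic.mul_left f⁻¹ h
    rw [inv_mul_cancel] at h'
    exact h'

/-- The natural homomorphism `Diff^∞_∂(𝔻, z) → Mod(Σ_{0,m}^1)`, sending a diffeomorphism to its
isotopy class. -/
noncomputable def mappingClass {m : ℕ} (z : Fin m → ℂ) : diffBdry z →* MappingClassGroup z :=
  (QuotientGroup.mk' (isotopicToId z)).comp (diffBdry z).subtype

/-- The relators of the standard presentation of the braid group on `n` strands, with generators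
`σ_i`, `i < n - 1`: the braid relations `σ_i σ_{i+1} σ_i = σ_{i+1} σ_i σ_{i+1}` and the
commutations `σ_i σ_j = σ_j σ_i` for `i + 2 ≤ j`. -/
def braidRelators (n : ℕ) : Set (FreeGroup (Fin (n - 1))) :=
  {r | ∃ i j : Fin (n - 1), (i : ℕ) + 1 = j ∧
      r = (FreeGroup.of i * FreeGroup.of j * FreeGroup.of i) *
        (FreeGroup.of j * FreeGroup.of i * FreeGroup.of j)⁻¹} ∪
  {r | ∃ i j : Fin (n - 1), (i : ℕ) + 2 ≤ j ∧
      r = (FreeGroup.of i * FreeGroup.of j) * (FreeGroup.of j * FreeGroup.of i)⁻¹}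

/-- The braid group `B_n`. -/
abbrev BraidGroup (n : ℕ) : Type := PresentedGroup (braidRelators n)

-- The braid group has the second presentation $\langle a,b\mid a^2=b^3\rangle$, with
-- $a=\sigma_1\sigma_2\sigma_1$ and $b=\sigma_1\sigma_2$ (`braidLift`). A half turn permutes three
-- symmetric collinear points, and a third of a turn permutes the vertices of an equilateral
-- triangle. Damp both rotations to the identity at the boundary circle, and conjugate the second by
-- a diffeomorphism supported in the rigidly rotated inner disc that carries the collinear points to
-- the triangle. The resulting diffeomorphisms satisfy $a^2=b^3$ exactly, both sides being the full
-- twist of the collar (`halfTurn_sq`, `thirdTurn_cube`). So $B_3$ acts by diffeomorphisms, and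
-- everything follows once the induced map $B_3\to\mathrm{Mod}$ is bijective
-- (`exists_bijective_braid`): the section is its inverse followed by the action.
--
-- Mapping classes are read off in the space of ordered configurations. The Alexander isotopy
-- attaches to a homeomorphism a path of configurations. Up to homotopy this path is multiplicative
-- (`pathAt_mul`) and independent of the chosen isotopy (`pathAt_homotopic_of_isotopy`). Conversely,
-- by isotopy extension, homotopic paths come from isotopic homeomorphisms
-- (`isotopic_of_homotopic`). In planar coordinates a configuration is a first point, a nonzero
-- width and a ratio in $\mathbb C\setminus\{0,1\}$, so a path is determined up to homotopy by its
-- ratio path and the winding of its width (`homotopic_of_lam`).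
--
-- Injectivity: a covering of $\mathbb C\setminus\{0,1\}$ with fibre $B_3/\langle a^2\rangle$ has
-- monodromy that recovers a braid modulo $a^2$ (`confTransport_rep`). A braid isotopic to the
-- identity is therefore a power of the full twist, and the winding of the width forces the exponent
-- to vanish (`eq_one_of_isotopic`).
--
-- Surjectivity: $\mathbb C\setminus\{0,1\}$ is the union of two contractible slit planes meeting in
-- three strips, each containing the ratio of some reordering of the base configuration. Cutting a
-- ratio path into pieces lying in slit planes shows that a braid traces it up to homotopy
-- (`exists_nearBraid`, `exists_lamPath_homotopic`); full twists then correct the winding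
-- (`exists_isotopic_braidDiff`). Other marked sets are reached by conjugating with a
-- diffeomorphism.

notation "𝕀" => unitInterval

/-! ### Homeomorphisms fixing the boundary, and continuous families of them -/

lemma Disc.norm_le (x : Disc) : ‖(x : ℂ)‖ ≤ 1 := mem_closedBall_zero_iff.1 x.2

/-- The homeomorphisms of the disc that fix the boundary circle pointwise. -/
def bdryFix : Subgroup (Disc ≃ₜ Disc) where
  carrier := {f | ∀ x : Disc, ‖(x : ℂ)‖ = 1 → f x = x}
  one_mem' := fun _ _ => rfl
  mul_mem' := by
    intro f g hf hg x hx
    change f (g x) = x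
    rw [hg x hx, hf x hx]
  inv_mem' := by
    intro f hf x hx
    change f.symm x = x
    rw [Homeomorph.symm_apply_eq, hf x hx]

lemma bdryFix.norm_lt {f : Disc ≃ₜ Disc} (hf : f ∈ bdryFix) {x : Disc} (hx : ‖(x : ℂ)‖ < 1) :
    ‖(f x : ℂ)‖ < 1 := by
  have h1 := (f x).norm_le
  refine lt_of_le_of_ne h1 fun h => ?_
  have h2 := f.injective (hf (f x) h)
  rw [h2] at h
  exact hx.ne h

/-- A jointly continuous family of homeomorphisms of the disc. -/
def ContFam {P : Type*} [TopologicalSpace P] (h : P → (Disc ≃ₜ Disc)) : Prop :=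
  Continuous fun p : P × Disc => h p.1 p.2

section ContFam
variable {P Q : Type*} [TopologicalSpace P] [TopologicalSpace Q]

lemma contFam_const (f : Disc ≃ₜ Disc) : ContFam fun _ : P => f :=
  f.continuous.comp continuous_snd

lemma ContFam.mul {h k : P → (Disc ≃ₜ Disc)} (hh : ContFam h) (hk : ContFam k) :
    ContFam fun p => h p * k p :=
  hh.comp (continuous_fst.prodMk hk)

lemma ContFam.comp {h : P → (Disc ≃ₜ Disc)} (hh : ContFam h) {φ : Q → P} (hφ : Continuous φ) :
    ContFam fun q => h (φ q) :=
  Continuous.comp (g := fun p : P × Disc => h p.1 p.2) hh (hφ.prodMap continuous_id)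

/-- The family is a continuous bijection of the compact Hausdorff space `P × Disc` over `P`, so its
inverse is continuous. -/
lemma ContFam.inv [CompactSpace P] [T2Space P] {h : P → (Disc ≃ₜ Disc)} (hh : ContFam h) :
    ContFam fun p => (h p)⁻¹ := by
  let e : P × Disc ≃ P × Disc :=
    { toFun := fun p => (p.1, h p.1 p.2)
      invFun := fun p => (p.1, (h p.1).symm p.2)
      left_inv := fun p => by simp
      right_inv := fun p => by simp }
  have he : Continuous e := continuous_fst.prodMk hh
  exact continuous_snd.comp (Continuous.homeoOfEquivCompactToT2 he).symm.continuous

lemma ContFam.continuous_apply {h : P → (Disc ≃ₜ Disc)} (hh : ContFam h) {φ : Q → P}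
    {x : Q → Disc} (hφ : Continuous φ) (hx : Continuous x) : Continuous fun q => h (φ q) (x q) :=
  Continuous.comp (g := fun p : P × Disc => h p.1 p.2) hh (hφ.prodMk hx)

end ContFam

/-! ### The Alexander isotopy -/

/-- The radial retraction of the plane onto the disc. -/
noncomputable def discProj (x : ℂ) : Disc :=
  ⟨((max 1 ‖x‖)⁻¹ : ℝ) • x, by
    have h : 0 < max 1 ‖x‖ := lt_of_lt_of_le one_pos (le_max_left _ _)
    rw [mem_closedBall_zero_iff, norm_smul, Real.norm_of_nonneg (by positivity), inv_mul_le_iff₀ h]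
    simp⟩

lemma continuous_discProj : Continuous discProj := by
  refine Continuous.subtype_mk (Continuous.smul (Continuous.inv₀ (continuous_const.max continuous_norm) fun x => ?_)
    continuous_id) _
  exact (lt_of_lt_of_le one_pos (le_max_left _ _)).ne'

lemma discProj_of_le {x : ℂ} (hx : ‖x‖ ≤ 1) : (discProj x : ℂ) = x := by
  simp [discProj, max_eq_left hx]

lemma discProj_coe (x : Disc) : discProj x = x :=
  Subtype.ext (discProj_of_le x.norm_le)

lemma norm_discProj_of_ge {x : ℂ} (hx : 1 ≤ ‖x‖) : ‖(discProj x : ℂ)‖ = 1 := by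
  have h : 0 < ‖x‖ := by linarith
  simp only [discProj, max_eq_right hx, norm_smul]
  rw [Real.norm_of_nonneg (by positivity), inv_mul_cancel₀ h.ne']

/-- The Alexander isotopy of a self-map of the disc, as a map of the plane. -/
noncomputable def alexFun (f : Disc → Disc) (t : ℝ) (x : ℂ) : ℂ :=
  x + (t : ℂ) * ((f (discProj ((t : ℂ)⁻¹ * x)) : ℂ) - discProj ((t : ℂ)⁻¹ * x))

lemma alexFun_zero (f : Disc → Disc) (x : ℂ) : alexFun f 0 x = x := by simp [alexFun]

lemma alexFun_of_le (f : Disc → Disc) {t : ℝ} (ht : 0 < t) {x : ℂ} (hx : ‖x‖ ≤ t) :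
    alexFun f t x = t * f (discProj ((t : ℂ)⁻¹ * x)) := by
  have h : ‖(t : ℂ)⁻¹ * x‖ ≤ 1 := by
    rw [norm_mul, norm_inv, Complex.norm_real, Real.norm_of_nonneg ht.le, inv_mul_le_iff₀ ht]
    simpa using hx
  have ht' : (t : ℂ) ≠ 0 := by exact_mod_cast ht.ne'
  rw [alexFun, mul_sub, discProj_of_le h, mul_inv_cancel_left₀ ht']
  ring

lemma alexFun_of_ge {f : Disc ≃ₜ Disc} (hf : f ∈ bdryFix) {t : ℝ} (ht : 0 ≤ t) {x : ℂ}
    (hx : t ≤ ‖x‖) : alexFun f t x = x := by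
  rcases ht.eq_or_lt with rfl | ht
  · exact alexFun_zero _ _
  have h : 1 ≤ ‖(t : ℂ)⁻¹ * x‖ := by
    rw [norm_mul, norm_inv, Complex.norm_real, Real.norm_of_nonneg ht.le, le_inv_mul_iff₀ ht]
    simpa using hx
  rw [alexFun, hf _ (norm_discProj_of_ge h)]
  simp

lemma norm_alexFun_le (f : Disc → Disc) {t : ℝ} (ht : 0 < t) {x : ℂ} (hx : ‖x‖ ≤ t) :
    ‖alexFun f t x‖ ≤ t := by
  rw [alexFun_of_le f ht hx, norm_mul, Complex.norm_real, Real.norm_of_nonneg ht.le]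
  have := (f (discProj ((t : ℂ)⁻¹ * x))).norm_le
  nlinarith

/-- On the disc of radius `t` the isotopy is `f` conjugated by a dilation, and outside it is the
identity; both descriptions respect composition. This makes each stage invertible and the isotopy
multiplicative in `f`. -/
lemma alexFun_comp {f g : Disc ≃ₜ Disc} (hf : f ∈ bdryFix) (hg : g ∈ bdryFix) {t : ℝ}
    (ht : 0 ≤ t) (x : ℂ) : alexFun f t (alexFun g t x) = alexFun (fun y => f (g y)) t x := by
  rcases ht.eq_or_lt with rfl | ht
  · simp [alexFun_zero]
  have ht' : (t : ℂ) ≠ 0 := by exact_mod_cast ht.ne'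
  rcases le_total ‖x‖ t with hx | hx
  · rw [alexFun_of_le f ht (norm_alexFun_le g ht hx), alexFun_of_le g ht hx,
      alexFun_of_le _ ht hx, inv_mul_cancel_left₀ ht', discProj_coe]
  · rw [alexFun_of_ge hg ht.le hx, alexFun_of_ge hf ht.le hx]
    exact (alexFun_of_ge (mul_mem hf hg) ht.le hx).symm

lemma alexFun_one (f : Disc → Disc) (x : Disc) : alexFun f 1 x = f x := by
  have h := x.norm_le
  rw [alexFun_of_le f one_pos h]
  simp [discProj_coe]

lemma alexFun_id (t : ℝ) (x : ℂ) : alexFun (fun y => y) t x = x := by simp [alexFun]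

lemma alexFun_mem {f : Disc ≃ₜ Disc} (hf : f ∈ bdryFix) (t : 𝕀) (x : Disc) :
    alexFun f t x ∈ Metric.closedBall (0 : ℂ) 1 := by
  rw [mem_closedBall_zero_iff]
  have hx := x.norm_le
  rcases le_total ‖(x : ℂ)‖ t with h | h
  · rcases t.2.1.eq_or_lt with h0 | h0
    · rwa [← h0, alexFun_zero]
    · exact (norm_alexFun_le f h0 h).trans t.2.2
  · rwa [alexFun_of_ge hf t.2.1 h]

/-- Only `t = 0` is delicate, since `t⁻¹ * x` has no limit there; the displacement is at most `2 *
|t|` whatever `f` is. -/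
lemma continuous_alexFun {P : Type*} [TopologicalSpace P] {h : P → (Disc ≃ₜ Disc)}
    (hh : ContFam h) : Continuous fun q : P × ℝ × ℂ => alexFun (h q.1) q.2.1 q.2.2 := by
  rw [continuous_iff_continuousAt]
  rintro ⟨p, t, x⟩
  by_cases ht : t = 0
  · subst ht
    refine ContinuousAt.add (by fun_prop) ?_
    rw [ContinuousAt]
    have hz : Filter.Tendsto (fun q : P × ℝ × ℂ => |q.2.1| * 2) (nhds (p, 0, x)) (nhds 0) := by
      have : Continuous fun q : P × ℝ × ℂ => |q.2.1| * 2 := by fun_prop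
      simpa using this.tendsto (p, 0, x)
    simp only [Complex.ofReal_zero, zero_mul]
    refine squeeze_zero_norm (fun q => ?_) hz
    rw [norm_mul, Complex.norm_real, Real.norm_eq_abs]
    refine mul_le_mul_of_nonneg_left ?_ (abs_nonneg _)
    refine (norm_sub_le _ _).trans ?_
    linarith [(h q.1 (discProj ((q.2.1 : ℂ)⁻¹ * q.2.2))).norm_le,
      (discProj ((q.2.1 : ℂ)⁻¹ * q.2.2)).norm_le]
  · have ht' : (t : ℂ) ≠ 0 := by exact_mod_cast ht
    have h1 : ContinuousAt (fun q : P × ℝ × ℂ => discProj ((q.2.1 : ℂ)⁻¹ * q.2.2)) (p, t, x) := by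
      refine continuous_discProj.continuousAt.comp (ContinuousAt.mul ?_ (by fun_prop))
      exact ContinuousAt.inv₀ (by fun_prop) ht'
    have h2 : ContinuousAt (fun q : P × ℝ × ℂ => h q.1 (discProj ((q.2.1 : ℂ)⁻¹ * q.2.2)))
        (p, t, x) :=
      ContinuousAt.comp (g := fun p : P × Disc => h p.1 p.2) hh.continuousAt
        (continuousAt_fst.prodMk h1)
    refine ContinuousAt.add (by fun_prop) (ContinuousAt.mul (by fun_prop) ?_)
    exact (continuous_subtype_val.continuousAt.comp h2).sub
      (continuous_subtype_val.continuousAt.comp h1)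

/-- The stage `t` of the Alexander isotopy from the identity to `f`. -/
noncomputable def alex (f : bdryFix) (t : 𝕀) : bdryFix :=
  ⟨{  toFun := fun x => ⟨alexFun f.1 t x, alexFun_mem f.2 t x⟩
      invFun := fun x => ⟨alexFun (f⁻¹).1 t x, alexFun_mem (f⁻¹).2 t x⟩
      left_inv := fun x => Subtype.ext <| by
        change alexFun (f⁻¹).1 t (alexFun f.1 t x) = x
        rw [alexFun_comp (f⁻¹).2 f.2 t.2.1]
        convert! alexFun_id t x using 2
        funext y
        exact f.1.symm_apply_apply y
      right_inv := fun x => Subtype.ext <| by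
        change alexFun f.1 t (alexFun (f⁻¹).1 t x) = x
        rw [alexFun_comp f.2 (f⁻¹).2 t.2.1]
        convert! alexFun_id t x using 2
        funext y
        exact f.1.apply_symm_apply y
      continuous_toFun := ((continuous_alexFun (contFam_const (P := Unit) f.1)).comp
        (by fun_prop : Continuous fun x : Disc => ((), (t : ℝ), (x : ℂ)))).subtype_mk _
      continuous_invFun := ((continuous_alexFun (contFam_const (P := Unit) (f⁻¹).1)).comp
        (by fun_prop : Continuous fun x : Disc => ((), (t : ℝ), (x : ℂ)))).subtype_mk _ },
    fun x hx => Subtype.ext (alexFun_of_ge f.2 t.2.1 (by rw [hx]; exact t.2.2))⟩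

lemma alex_ext {f g : bdryFix} (h : ∀ x, f.1 x = g.1 x) : f = g :=
  Subtype.ext (Homeomorph.ext h)

@[simp] lemma alex_zero (f : bdryFix) : alex f 0 = 1 :=
  alex_ext fun _ => Subtype.ext (alexFun_zero _ _)

@[simp] lemma alex_one_right (f : bdryFix) : alex f 1 = f :=
  alex_ext fun _ => Subtype.ext (alexFun_one _ _)

@[simp] lemma alex_one_left (t : 𝕀) : alex 1 t = 1 :=
  alex_ext fun _ => Subtype.ext (alexFun_id _ _)

lemma alex_mul (f g : bdryFix) (t : 𝕀) : alex (f * g) t = alex f t * alex g t :=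
  alex_ext fun x => Subtype.ext (alexFun_comp f.2 g.2 t.2.1 x).symm

lemma ContFam.alex {P : Type*} [TopologicalSpace P] {h : P → bdryFix}
    (hh : ContFam fun p => (h p).1) : ContFam fun q : P × 𝕀 => (alex (h q.1) q.2).1 :=
  ((continuous_alexFun hh).comp (by fun_prop :
    Continuous fun q : (P × 𝕀) × Disc => (q.1.1, (q.1.2 : ℝ), (q.2 : ℂ)))).subtype_mk _

lemma contFam_alex (f : bdryFix) : ContFam fun t => (alex f t).1 :=
  (ContFam.alex (contFam_const (P := Unit) f.1)).comp (by fun_prop : Continuous fun t : 𝕀 => ((), t))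

/-! ### Configurations of three points -/

/-- Ordered configurations of three distinct points in the open disc. -/
def Conf : Type := {c : Fin 3 → Disc // Function.Injective c ∧ ∀ i, ‖(c i : ℂ)‖ < 1}

instance : TopologicalSpace Conf := inferInstanceAs (TopologicalSpace (Subtype _))

/-- The action of a homeomorphism on configurations. -/
noncomputable def act (f : bdryFix) (c : Conf) : Conf :=
  ⟨fun i => f.1 (c.1 i), f.1.injective.comp c.2.1, fun i => bdryFix.norm_lt f.2 (c.2.2 i)⟩

/-- Reordering of a configuration. -/
noncomputable def Conf.perm (c : Conf) (σ : Equiv.Perm (Fin 3)) : Conf :=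
  ⟨fun i => c.1 (σ i), c.2.1.comp σ.injective, fun i => c.2.2 (σ i)⟩

@[simp] lemma act_one (c : Conf) : act 1 c = c := rfl
lemma act_mul (f g : bdryFix) (c : Conf) : act (f * g) c = act f (act g c) := rfl
lemma act_perm (f : bdryFix) (c : Conf) (σ) : act f (c.perm σ) = (act f c).perm σ := rfl

lemma continuous_perm (σ : Equiv.Perm (Fin 3)) : Continuous fun c : Conf => c.perm σ :=
  Continuous.subtype_mk (f := fun (c : Conf) i => c.1 (σ i)) (continuous_pi fun i =>
    (continuous_apply (σ i)).comp continuous_subtype_val) _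

lemma continuous_act {P Q : Type*} [TopologicalSpace P] [TopologicalSpace Q] {h : P → bdryFix}
    (hh : ContFam fun p => (h p).1) {φ : Q → P} {c : Q → Conf} (hφ : Continuous φ)
    (hc : Continuous c) : Continuous fun q => act (h (φ q)) (c q) :=
  Continuous.subtype_mk (continuous_pi fun i => hh.continuous_apply hφ
    ((continuous_apply i).comp (continuous_subtype_val.comp hc))) _

/-- The path of configurations traced by the Alexander isotopy. -/
noncomputable def pathAt (f : bdryFix) (c : Conf) : Path c (act f c) where
  toFun t := act (alex f t) c
  continuous_toFun := continuous_act (contFam_alex f) continuous_id continuous_const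
  source' := by simp
  target' := by simp

instance : ContractibleSpace 𝕀 := (convex_Icc (0 : ℝ) 1).contractibleSpace ⟨0, by simp⟩

/-- The parameter square is simply connected, so its diagonal deforms to two of its sides. -/
lemma homotopic_of_square {Y : Type*} [TopologicalSpace Y] {F : 𝕀 × 𝕀 → Y} (hF : Continuous F)
    {a b c : Y} {p : Path a b} {q : Path b c} {r : Path a c} (hp : ∀ t, p t = F (t, 0))
    (hq : ∀ t, q t = F (1, t)) (hr : ∀ t, r t = F (t, t)) : r.Homotopic (p.trans q) := by
  let d : Path ((0 : 𝕀), (0 : 𝕀)) (1, 1) := ⟨⟨fun t => (t, t), by fun_prop⟩, rfl, rfl⟩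
  let e : Path ((0 : 𝕀), (0 : 𝕀)) (1, 0) := ⟨⟨fun t => (t, 0), by fun_prop⟩, rfl, rfl⟩
  let e' : Path ((1 : 𝕀), (0 : 𝕀)) (1, 1) := ⟨⟨fun t => (1, t), by fun_prop⟩, rfl, rfl⟩
  have h : d.Homotopic (e.trans e') := SimplyConnectedSpace.paths_homotopic _ _
  have h' := h.map ⟨F, hF⟩
  have ha : a = F (0, 0) := by rw [← hp 0, p.source]
  have hb : b = F (1, 0) := by rw [← hp 1, p.target]
  have hc : c = F (1, 1) := by rw [← hq 1, q.target]
  subst ha hb hc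
  convert! h' using 1
  · ext t; exact hr t
  · rw [Path.map_trans]
    congr 1
    · ext t; exact hp t
    · ext t; exact hq t

/-- The two Alexander isotopies can be run with independent times; the diagonal of that square is
the isotopy of the product by `alex_mul`. -/
lemma pathAt_mul (f g : bdryFix) (c : Conf) :
    (pathAt (f * g) c).Homotopic ((pathAt g c).trans (pathAt f (act g c))) := by
  refine homotopic_of_square (F := fun s : 𝕀 × 𝕀 => act (alex f s.2) (act (alex g s.1) c))
    ?_ (fun t => ?_) (fun t => ?_) (fun t => ?_)
  · exact continuous_act (contFam_alex f) continuous_snd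
      (continuous_act (contFam_alex g) continuous_fst continuous_const)
  · simp [pathAt]
  · change act (alex f t) (act g c) = _
    simp
  · change act (alex (f * g) t) c = _
    rw [alex_mul]
    rfl

/-- In the square `alex (h s) t` the diagonal deforms one way to the Alexander trace of `f` and the
other way to the trace of `h`. Hence any convenient isotopy may be used to compute `pathAt`. -/
lemma pathAt_homotopic_of_isotopy {f : bdryFix} {c c' : Conf} {h : 𝕀 → bdryFix}
    (hh : ContFam fun t => (h t).1) (h0 : h 0 = 1) (h1 : h 1 = f) (r : Path c c')
    (hr : ∀ t, r t = act (h t) c) (hc : c' = act f c) :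
    (pathAt f c).Homotopic (r.cast rfl hc.symm) := by
  subst hc
  have hF : Continuous fun s : 𝕀 × 𝕀 => act (alex (h s.1) s.2) c :=
    continuous_act hh.alex continuous_id continuous_const
  let d : Path c (act f c) := ⟨⟨fun t => act (alex (h t) t) c,
    hF.comp (by fun_prop : Continuous fun t : 𝕀 => (t, t))⟩, by simp, by simp [h1]⟩
  have e1 : d.Homotopic ((Path.refl c).trans (pathAt f c)) :=
    homotopic_of_square hF (fun t => by simp) (fun t => by simp [pathAt, h1]) (fun t => rfl)
  have e2 : d.Homotopic ((Path.refl c).trans r) :=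
    homotopic_of_square (F := fun s : 𝕀 × 𝕀 => act (alex (h s.2) s.1) c)
      (hF.comp continuous_swap) (fun t => by simp [h0]) (fun t => by simp [hr]) (fun t => rfl)
  have e3 : ∀ q : Path c (act f c), ((Path.refl c).trans q).Homotopic q :=
    fun q => ⟨Path.Homotopy.reflTrans q⟩
  exact ((e3 _).symm.trans e1.symm).trans (e2.trans (e3 r))

lemma pathAt_one (c : Conf) : pathAt 1 c = Path.refl c := by
  ext t
  change act (alex 1 t) c = c
  simp

/-! ### Small pushes and isotopy extension -/

/-- A homeomorphism of the disc that is smooth together with its inverse. -/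
def IsDiffeo (f : Disc ≃ₜ Disc) : Prop := IsSmoothDisc f ∧ IsSmoothDisc f.symm

lemma isDiffeo_one : IsDiffeo 1 := ⟨isSmoothDisc_id, isSmoothDisc_id⟩

lemma IsDiffeo.mul {f g : Disc ≃ₜ Disc} (hf : IsDiffeo f) (hg : IsDiffeo g) : IsDiffeo (f * g) :=
  ⟨hf.1.comp hg.1, hg.2.comp hf.2⟩

lemma IsDiffeo.inv {f : Disc ≃ₜ Disc} (hf : IsDiffeo f) : IsDiffeo f⁻¹ := ⟨hf.2, hf.1⟩

/-- A homeomorphism of the plane that is the identity outside the open unit disc restricts to the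
disc. -/
lemma exists_disc_restrict (e : ℂ ≃ₜ ℂ) (he : ∀ x, 1 ≤ ‖x‖ → e x = x) :
    ∃ f : Disc ≃ₜ Disc, (∀ x, (f x : ℂ) = e x) ∧ ∀ x, (f.symm x : ℂ) = e.symm x := by
  have key : ∀ e : ℂ ≃ₜ ℂ, (∀ x, 1 ≤ ‖x‖ → e x = x) → ∀ x : Disc,
      e x ∈ Metric.closedBall (0 : ℂ) 1 := by
    intro e he x
    rw [mem_closedBall_zero_iff]
    by_contra! h
    have := e.injective (he (e x) h.le)
    rw [this] at h
    exact absurd x.norm_le (not_le.2 h)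
  have he' : ∀ x, 1 ≤ ‖x‖ → e.symm x = x := fun x hx => by
    rw [Homeomorph.symm_apply_eq, he x hx]
  exact ⟨{ toFun := fun x => ⟨e x, key e he x⟩
           invFun := fun x => ⟨e.symm x, key e.symm he' x⟩
           left_inv := fun x => Subtype.ext (e.symm_apply_apply _)
           right_inv := fun x => Subtype.ext (e.apply_symm_apply _)
           continuous_toFun := (e.continuous.comp continuous_subtype_val).subtype_mk _
           continuous_invFun := (e.symm.continuous.comp continuous_subtype_val).subtype_mk _ },
    fun _ => rfl, fun _ => rfl⟩

/-- The self-map of the plane that translates a neighbourhood of `c i` by `d i`. -/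
noncomputable def push (χ : ContDiffBump (0 : ℂ)) (c d : Fin 3 → ℂ) (x : ℂ) : ℂ :=
  x + ∑ i, χ (x - c i) • d i

lemma contDiff_push (χ : ContDiffBump (0 : ℂ)) (c d : Fin 3 → ℂ) : ContDiff ℝ ∞ (push χ c d) := by
  refine contDiff_id.add (ContDiff.sum fun i _ => ?_)
  have h : ContDiff ℝ ∞ fun x => χ (x - c i) := χ.contDiff.comp (contDiff_id.sub contDiff_const)
  exact h.smul contDiff_const

lemma push_eq_self {χ : ContDiffBump (0 : ℂ)} {c : Fin 3 → ℂ} (d : Fin 3 → ℂ) {x : ℂ}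
    (hx : ∀ i, χ.rOut ≤ ‖x - c i‖) : push χ c d x = x := by
  rw [push, Finset.sum_eq_zero, add_zero]
  intro i _
  rw [χ.zero_of_le_dist (by simpa using hx i), zero_smul]

lemma push_apply_point {χ : ContDiffBump (0 : ℂ)} {c d : Fin 3 → ℂ} (i : Fin 3)
    (h : ∀ j, j ≠ i → χ.rOut ≤ ‖c i - c j‖) : push χ c d (c i) = c i + d i := by
  rw [push, Finset.sum_eq_single i]
  · rw [χ.one_of_mem_closedBall, one_smul]
    simpa using χ.rIn_pos.le
  · intro j _ hj
    rw [χ.zero_of_le_dist (by simpa using h j hj), zero_smul]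
  · simp

/-- The displacement is a contraction, so the push is a bi-Lipschitz perturbation of the identity
with invertible derivative everywhere; this gives a smooth inverse without constructing it. -/
lemma exists_push {χ : ContDiffBump (0 : ℂ)} {L : NNReal} (hL : LipschitzWith L χ) {R : ℝ}
    (hR : R ≤ 1) {c d : Fin 3 → ℂ} (hc : ∀ i, ‖c i‖ + χ.rOut ≤ R)
    (hd : ∀ i, L * ‖d i‖ ≤ 1 / 6) :
    ∃ f : Disc ≃ₜ Disc, IsDiffeo f ∧ ∀ x, (f x : ℂ) = push χ c d x := by
  set g : ℂ → ℂ := fun x => ∑ i, χ (x - c i) • d i with hg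
  have hgL : LipschitzWith (1 / 2) g := by
    refine LipschitzWith.of_dist_le_mul fun x y => ?_
    rw [dist_eq_norm, hg]
    simp only
    rw [← Finset.sum_sub_distrib]
    refine (norm_sum_le _ _).trans ?_
    -- Three bumps, each contributing a Lipschitz constant of at most 1/6, give 1/2 in total.
    have : ∀ i ∈ Finset.univ, ‖χ (x - c i) • d i - χ (y - c i) • d i‖ ≤ 1 / 6 * dist x y := by
      intro i _
      rw [← sub_smul, norm_smul]
      have h1 := hL.dist_le_mul (x - c i) (y - c i)
      rw [dist_sub_right, dist_eq_norm (χ _)] at h1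
      calc _ ≤ (L * dist x y) * ‖d i‖ := by gcongr
        _ = (L * ‖d i‖) * dist x y := by ring
        _ ≤ _ := by gcongr; exact hd i
    refine (Finset.sum_le_sum this).trans ?_
    simp only [Finset.sum_const, Finset.card_univ, Fintype.card_fin, NNReal.coe_div,
      NNReal.coe_one, NNReal.coe_ofNat, nsmul_eq_mul]
    push_cast
    linarith
  have hpush : push χ c d = fun x => x + g x := rfl
  have happ : ApproximatesLinearOn (push χ c d)
      ((ContinuousLinearEquiv.refl ℝ ℂ : ℂ ≃L[ℝ] ℂ) : ℂ →L[ℝ] ℂ) Set.univ (1 / 2) := by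
    rw [ApproximatesLinearOn.approximatesLinearOn_iff_lipschitzOnWith, lipschitzOnWith_univ]
    convert! hgL using 1
    ext x
    simp [hpush]
  have hN : (1 / 2 : NNReal) < ‖((ContinuousLinearEquiv.refl ℝ ℂ).symm : ℂ →L[ℝ] ℂ)‖₊⁻¹ := by
    have : ‖((ContinuousLinearEquiv.refl ℝ ℂ).symm : ℂ →L[ℝ] ℂ)‖₊ = 1 :=
      NNReal.eq (ContinuousLinearMap.norm_id (𝕜 := ℝ) (E := ℂ))
    rw [this]
    norm_num
  let e : ℂ ≃ₜ ℂ := happ.toHomeomorph _ (Or.inr hN)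
  have he : ∀ x, e x = push χ c d x := fun _ => rfl
  have hesm : ContDiff ℝ ∞ e := contDiff_push χ c d
  have hgsm : ContDiff ℝ ∞ g := by
    have : g = fun x => push χ c d x - x := by ext x; simp [hpush]
    rw [this]
    exact (contDiff_push χ c d).sub contDiff_id
  have hn : ∀ x, ‖-fderiv ℝ g x‖ < 1 := fun x => by
    rw [norm_neg]
    refine (norm_fderiv_le_of_lipschitz ℝ hgL).trans_lt ?_
    norm_num
  -- The derivative is `1 + fderiv ℝ g x` with the second term of norm less than 1, hence a unit by
  -- the Neumann series.
  have hd' : ∀ x, HasFDerivAt e ((ContinuousLinearEquiv.unitsEquiv ℝ ℂ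
      (Units.oneSub (-fderiv ℝ g x) (hn x)) : ℂ ≃L[ℝ] ℂ) : ℂ →L[ℝ] ℂ) x := by
    intro x
    have h1 : HasFDerivAt g (fderiv ℝ g x) x :=
      (hgsm.differentiable (by simp)).differentiableAt.hasFDerivAt
    have h2 := (hasFDerivAt_id x).add h1
    convert! h2 using 1
    ext v
    simp [ContinuousLinearEquiv.unitsEquiv_apply]
  have hsymm : ContDiff ℝ ∞ e.symm := e.contDiff_symm hd' hesm
  have hout : ∀ x, 1 ≤ ‖x‖ → e x = x := fun x hx => push_eq_self d fun i => by
    have := norm_sub_norm_le x (c i)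
    linarith [hc i]
  obtain ⟨f, hf, hf'⟩ := exists_disc_restrict e hout
  exact ⟨f, ⟨⟨e, hesm.contDiffOn, fun x => (hf x).symm⟩,
    ⟨e.symm, hsymm.contDiffOn, fun x => (hf' x).symm⟩⟩, hf⟩

lemma exists_pos_le_of_compact {Q : Type*} [TopologicalSpace Q] [CompactSpace Q] {g : Q → ℝ}
    (hg : Continuous g) (hpos : ∀ q, 0 < g q) : ∃ r > 0, ∀ q, r ≤ g q := by
  rcases isEmpty_or_nonempty Q with h | h
  · exact ⟨1, one_pos, fun q => (h.false q).elim⟩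
  obtain ⟨q, -, hq⟩ := isCompact_univ.exists_isMinOn Set.univ_nonempty hg.continuousOn
  exact ⟨g q, hpos q, fun q' => hq (Set.mem_univ q')⟩

lemma Conf.continuous_coord (i : Fin 3) : Continuous fun c : Conf => (c.1 i : ℂ) :=
  continuous_subtype_val.comp ((continuous_apply i).comp continuous_subtype_val)

/-- Isotopy extension: a family of paths of configurations is followed by a continuous family of
diffeomorphisms. -/
theorem exists_isotopy_extension {P : Type*} [PseudoMetricSpace P] [CompactSpace P]
    {N : P × 𝕀 → Conf} (hN : Continuous N) {R : ℝ} (hR : R ≤ 1)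
    (hNR : ∀ q i, ‖((N q).1 i : ℂ)‖ < R) :
    ∃ K : P → (Disc ≃ₜ Disc), ContFam K ∧ (∀ p, IsDiffeo (K p)) ∧
      (∀ p (x : Disc), R ≤ ‖(x : ℂ)‖ → K p x = x) ∧
      (∀ p i, K p ((N (p, 0)).1 i) = (N (p, 1)).1 i) ∧
      ∀ p, (∀ t, N (p, t) = N (p, 0)) → K p = 1 := by
  have hcont : ∀ i, Continuous fun q => ((N q).1 i : ℂ) := fun i =>
    (Conf.continuous_coord i).comp hN
  -- By compactness one bump radius serves for all times and parameters: bumps stay inside radius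
  -- `R`, and each vanishes at the other points. The value 1 on the diagonal `i = j` is a harmless
  -- filler.
  obtain ⟨r, hr, hr'⟩ : ∃ r > 0, ∀ q : (P × 𝕀) × Fin 3 × Fin 3, r ≤
      min (R - ‖((N q.1).1 q.2.1 : ℂ)‖)
        (if q.2.1 = q.2.2 then 1 else ‖((N q.1).1 q.2.1 : ℂ) - (N q.1).1 q.2.2‖) := by
    refine exists_pos_le_of_compact ?_ ?_
    · refine continuous_prod_of_discrete_right.2 ?_
      rintro ⟨i, j⟩
      refine (continuous_const.sub (hcont i).norm).min ?_
      dsimp only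
      split_ifs
      · exact continuous_const
      · exact ((hcont i).sub (hcont j)).norm
    · rintro ⟨q, i, j⟩
      refine lt_min (sub_pos.2 (hNR q i)) ?_
      dsimp only
      split_ifs with h
      · exact one_pos
      · rw [norm_pos_iff, sub_ne_zero]
        exact fun h' => h ((N q).2.1 (Subtype.ext h'))
  let χ : ContDiffBump (0 : ℂ) := ⟨r / 2, r, by linarith, by linarith⟩
  obtain ⟨L, hL⟩ : ∃ L, LipschitzWith L χ :=
    (χ.contDiff (n := 1)).lipschitzWith_of_hasCompactSupport χ.hasCompactSupport one_ne_zero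
  have hsep : ∀ q i j, j ≠ i → χ.rOut ≤ ‖((N q).1 i : ℂ) - (N q).1 j‖ := by
    intro q i j hij
    have := (le_min_iff.1 (hr' (q, i, j))).2
    simpa [hij.symm] using this
  have hbd : ∀ q i, ‖((N q).1 i : ℂ)‖ + χ.rOut ≤ R := by
    intro q i
    have := (le_min_iff.1 (hr' (q, i, i))).1
    change _ + r ≤ R
    dsimp only at this
    linarith
  obtain ⟨δ, hδ, hδ'⟩ : ∃ δ > 0, ∀ i p (s t : 𝕀), |(s : ℝ) - t| < δ →
      L * ‖((N (p, s)).1 i : ℂ) - (N (p, t)).1 i‖ ≤ 1 / 6 := by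
    have huc : UniformContinuous fun q (i : Fin 3) => ((N q).1 i : ℂ) :=
      CompactSpace.uniformContinuous_of_continuous (continuous_pi hcont)
    -- `L + 1` rather than `L` keeps the denominator positive when `L = 0`.
    obtain ⟨δ, hδ, h⟩ := Metric.uniformContinuous_iff.1 huc (1 / (6 * (L + 1))) (by positivity)
    refine ⟨δ, hδ, fun i p s t hst => ?_⟩
    have h1 := h (a := (p, s)) (b := (p, t)) (by
      rw [Prod.dist_eq, dist_self, max_lt_iff]
      exact ⟨hδ, hst⟩)
    have h2 := (dist_le_pi_dist _ _ i).trans h1.le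
    rw [dist_eq_norm, le_div_iff₀ (by positivity)] at h2
    have : 0 ≤ ‖((N (p, s)).1 i : ℂ) - (N (p, t)).1 i‖ := norm_nonneg _
    nlinarith
  obtain ⟨n, hn⟩ := exists_nat_one_div_lt hδ
  let τ : ℕ → 𝕀 := fun k => Set.projIcc 0 1 zero_le_one ((k : ℝ) / (n + 1))
  have hτ : ∀ k, |((τ (k + 1) : 𝕀) : ℝ) - τ k| < δ := by
    intro k
    refine lt_of_le_of_lt ?_ hn
    refine (Set.abs_projIcc_sub_projIcc zero_le_one).trans (le_of_eq ?_)
    rw [← sub_div, abs_of_nonneg] <;> simp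
    positivity
  -- Over each short time step a single push carries the points along; the pushes are composed. A
  -- constant path gives zero displacements, hence the identity, which is the last clause.
  have main : ∀ k, ∃ K : P → (Disc ≃ₜ Disc), ContFam K ∧ (∀ p, IsDiffeo (K p)) ∧
      (∀ p (x : Disc), R ≤ ‖(x : ℂ)‖ → K p x = x) ∧
      (∀ p i, K p ((N (p, 0)).1 i) = (N (p, τ k)).1 i) ∧
      ∀ p, (∀ t, N (p, t) = N (p, 0)) → K p = 1 := by
    intro k
    induction k with
    | zero =>
      refine ⟨fun _ => 1, contFam_const 1, fun _ => isDiffeo_one, fun _ _ _ => rfl, fun p i => ?_,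
        fun _ _ => rfl⟩
      have : τ 0 = 0 := by simp [τ]
      rw [this]
      rfl
    | succ k ih =>
      obtain ⟨K, h1, h2, h3, h4, h5⟩ := ih
      have hex := fun p => exists_push hL hR (c := fun i => ((N (p, τ k)).1 i : ℂ))
        (d := fun i => ((N (p, τ (k + 1))).1 i : ℂ) - (N (p, τ k)).1 i) (hbd _)
        (fun i => hδ' i p _ _ (hτ k))
      choose f hf hfx using hex
      refine ⟨fun p => f p * K p, ContFam.mul ?_ h1, fun p => (hf p).mul (h2 p), ?_, ?_, ?_⟩
      · refine continuous_induced_rng.2 ?_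
        refine Continuous.congr (f := fun q : P × Disc =>
          push χ (fun i => ((N (q.1, τ k)).1 i : ℂ))
            (fun i => ((N (q.1, τ (k + 1))).1 i : ℂ) - (N (q.1, τ k)).1 i) q.2) ?_
          fun q => (hfx q.1 q.2).symm
        have hc' : ∀ i t, Continuous fun q : P × Disc => ((N (q.1, t)).1 i : ℂ) := fun i t =>
          (hcont i).comp (by fun_prop)
        refine Continuous.add (by fun_prop) (continuous_finsetSum _ fun i _ => ?_)
        refine Continuous.smul (χ.continuous.comp ?_) ((hc' i _).sub (hc' i _))
        exact (continuous_subtype_val.comp continuous_snd).sub (hc' i _)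
      · intro p x hx
        change f p (K p x) = x
        rw [h3 p x hx]
        refine Subtype.ext ((hfx p x).trans (push_eq_self _ fun i => ?_))
        have := norm_sub_norm_le (x : ℂ) ((N (p, τ k)).1 i)
        linarith [hbd (p, τ k) i]
      · intro p i
        change f p (K p _) = _
        rw [h4 p i]
        refine Subtype.ext ((hfx p _).trans ?_)
        rw [push_apply_point (c := fun i => ((N (p, τ k)).1 i : ℂ)) i
          fun j hj => hsep _ _ _ hj]
        ring
      · intro p hp
        change f p * K p = 1
        rw [h5 p hp, mul_one]
        refine Homeomorph.ext fun x => Subtype.ext ((hfx p x).trans ?_)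
        simp [push, hp (τ k), hp (τ (k + 1))]
  obtain ⟨K, h1, h2, h3, h4, h5⟩ := main (n + 1)
  have hlast : τ (n + 1) = 1 := by
    have : ((n : ℝ) + 1) / (n + 1) = 1 := div_self (by positivity)
    simp [τ, this]
  rw [hlast] at h4
  exact ⟨K, h1, h2, h3, h4, h5⟩

/-! ### From homotopic configuration paths to isotopic homeomorphisms -/

section Isotopy
variable {m : ℕ} {z : Fin m → ℂ}

lemma Isotopic.trans {f g h : homeoBdry z} (h1 : Isotopic f g) (h2 : Isotopic g h) :
    Isotopic f h :=
  (mappingClass_eq_iff f h).1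
    (((mappingClass_eq_iff f g).2 h1).trans ((mappingClass_eq_iff g h).2 h2))

/-- A homeomorphism preserving the marked points, as a homeomorphism fixing the boundary. -/
def toBdryFix (z : Fin m → ℂ) : homeoBdry z →* bdryFix where
  toFun f := ⟨f.1, f.2.1⟩
  map_one' := rfl
  map_mul' _ _ := rfl

end Isotopy

lemma mem_markedSet_iff {z : Fin 3 → ℂ} {c : Conf} (hc : ∀ i, z i = c.1 i) {x : Disc} :
    x ∈ markedSet z ↔ ∃ i, c.1 i = x := by
  refine exists_congr fun i => ?_
  rw [hc, Subtype.ext_iff]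

/-- Such a `k` agrees with `f` on every marked point, so it has the same image of the marked set. -/
lemma mem_homeoBdry_of_act_eq {z : Fin 3 → ℂ} {c : Conf} (hc : ∀ i, z i = c.1 i)
    (f : homeoBdry z) {k : bdryFix} (hk : act k c = act (toBdryFix z f) c) :
    k.1 ∈ homeoBdry z := by
  have hk' : ∀ i, k.1 (c.1 i) = f.1 (c.1 i) := fun i => congrFun (congrArg Subtype.val hk) i
  refine ⟨k.2, fun x => ⟨fun hx => ?_, fun hx => ?_⟩⟩
  · have hy : f.1 (f.1.symm (k.1 x)) ∈ markedSet z := by rwa [Homeomorph.apply_symm_apply]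
    obtain ⟨i, hi⟩ := (mem_markedSet_iff hc).1 ((f.2.2 _).1 hy)
    have : k.1 (c.1 i) = k.1 x := by rw [hk', hi, Homeomorph.apply_symm_apply]
    exact (mem_markedSet_iff hc).2 ⟨i, k.1.injective this⟩
  · obtain ⟨i, rfl⟩ := (mem_markedSet_iff hc).1 hx
    rw [hk', f.2.2]
    exact hx

lemma isotopic_of_family {z : Fin 3 → ℂ} {c : Conf} (hc : ∀ i, z i = c.1 i)
    {f g h : homeoBdry z} {k : 𝕀 → bdryFix} (hk : ContFam fun t => (k t).1)
    (hkf : ∀ t, act (k t) c = act (toBdryFix z f) c) (h0 : k 0 = toBdryFix z g)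
    (h1 : k 1 = toBdryFix z h) : Isotopic g h := by
  refine ⟨fun t => ⟨(k t).1, mem_homeoBdry_of_act_eq hc f (hkf t)⟩, hk, ?_, ?_⟩
  · exact Subtype.ext (by change (k 0).1 = g.1; rw [h0]; rfl)
  · exact Subtype.ext (by change (k 1).1 = h.1; rw [h1]; rfl)

lemma act_inv_act (f : bdryFix) (c : Conf) : act f⁻¹ (act f c) = c := by
  rw [← act_mul, inv_mul_cancel, act_one]

lemma act_inv_act_of_eq {f g : bdryFix} {c : Conf} (h : act f c = act g c) :
    act f⁻¹ (act g c) = c := by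
  rw [← h, act_inv_act]

/-- Homeomorphisms tracing homotopic paths of configurations are isotopic relative to the marked
points. -/
theorem isotopic_of_homotopic {z : Fin 3 → ℂ} {c : Conf} (hc : ∀ i, z i = c.1 i)
    (f g : homeoBdry z) (hfg : act (toBdryFix z f) c = act (toBdryFix z g) c)
    (h : (pathAt (toBdryFix z f) c).Homotopic ((pathAt (toBdryFix z g) c).cast rfl hfg)) :
    Isotopic f g := by
  obtain ⟨F⟩ := h
  -- For fixed `(s, t)` the last variable runs along the homotopy from `c` to `F (s, t)`, so
  -- extension yields `K (s, t)` carrying `c` to `F (s, t)`.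
  have hN : Continuous fun q : (𝕀 × 𝕀) × 𝕀 => F (q.1.1, q.1.2 * q.2) :=
    F.continuous.comp (by fun_prop)
  obtain ⟨K, h1, -, h3, h4, h5⟩ := exists_isotopy_extension hN le_rfl
    (fun q i => (F (q.1.1, q.1.2 * q.2)).2.2 i)
  simp only [mul_zero, mul_one, Path.Homotopy.source] at h4 h5
  let k : 𝕀 × 𝕀 → bdryFix := fun p => ⟨K p, fun x hx => h3 p x hx.ge⟩
  have hk : ContFam fun p => (k p).1 := h1
  have hkc : ∀ p, act (k p) c = F p := fun p => Subtype.ext (funext fun i => h4 p i)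
  have hk0 : ∀ s, k (s, 0) = 1 := fun s => Subtype.ext (h5 _ fun t => by simp)
  have hk1 : ∀ s, act (k (s, 1)) c = act (toBdryFix z f) c := fun s => by
    rw [hkc, F.target]
  let k' : 𝕀 → homeoBdry z := fun s => ⟨(k (s, 1)).1, mem_homeoBdry_of_act_eq hc f (hk1 s)⟩
  -- Where a row of `F` is the Alexander trace of `g`, the factor `(k (s, t))⁻¹ * alex g t` fixes
  -- `c`. Premultiplying by `k (s, 1)` gives a path from `k (s, 1)` to `g` with constant effect on
  -- `c`.
  have side : ∀ (s : 𝕀) (g : homeoBdry z), act (toBdryFix z f) c = act (toBdryFix z g) c →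
      (∀ t, F (s, t) = act (alex (toBdryFix z g) t) c) → Isotopic (k' s) g := by
    intro s g hg hF
    refine isotopic_of_family hc (f := f)
      (k := fun t => k (s, 1) * ((k (s, t))⁻¹ * alex (toBdryFix z g) t)) ?_ (fun t => ?_) ?_ ?_
    · exact ContFam.mul (contFam_const _)
        (ContFam.mul (ContFam.inv (hk.comp (by fun_prop))) (contFam_alex _))
    · rw [act_mul, act_mul, act_inv_act_of_eq (by rw [hkc, hF]), hk1]
    · simp only [hk0, alex_zero, inv_one, mul_one]
      rfl
    · simp
  have e1 : Isotopic (k' 0) f := side 0 f rfl fun t => F.map_zero_left t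
  have e2 : Isotopic (k' 1) g := side 1 g hfg fun t => F.map_one_left t
  have e3 : Isotopic (k' 0) (k' 1) :=
    isotopic_of_family hc (f := f) (k := fun s => k (s, 1)) (hk.comp (by fun_prop)) hk1 rfl rfl
  exact e1.symm.trans (e3.trans e2)

/-! ### Coordinates on the configuration space -/

/-- The radial diffeomorphism from the open disc to the plane. -/
noncomputable def toPlane (x : ℂ) : ℂ := ((√(1 - ‖x‖ ^ 2))⁻¹ : ℝ) * x

/-- The radial diffeomorphism from the plane to the open disc. -/
noncomputable def ofPlane (y : ℂ) : ℂ := ((√(1 + ‖y‖ ^ 2))⁻¹ : ℝ) * y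

lemma norm_ofPlane_sq (y : ℂ) : ‖ofPlane y‖ ^ 2 = ‖y‖ ^ 2 / (1 + ‖y‖ ^ 2) := by
  have h : 0 ≤ 1 + ‖y‖ ^ 2 := by positivity
  rw [ofPlane, norm_mul, Complex.norm_real, mul_pow, Real.norm_eq_abs, sq_abs, inv_pow,
    Real.sq_sqrt h]
  ring

lemma norm_ofPlane_lt (y : ℂ) : ‖ofPlane y‖ < 1 := by
  have h := norm_ofPlane_sq y
  have h' : ‖y‖ ^ 2 / (1 + ‖y‖ ^ 2) < 1 := by
    rw [div_lt_one (by positivity)]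
    linarith
  rw [← h] at h'
  exact (sq_lt_one_iff₀ (norm_nonneg _)).1 h'

lemma toPlane_ofPlane (y : ℂ) : toPlane (ofPlane y) = y := by
  have h : 0 < 1 + ‖y‖ ^ 2 := by positivity
  have h1 : 1 - ‖ofPlane y‖ ^ 2 = (1 + ‖y‖ ^ 2)⁻¹ := by
    rw [norm_ofPlane_sq]
    field_simp
    ring
  rw [toPlane, h1, ofPlane, ← mul_assoc, ← Complex.ofReal_mul, Real.sqrt_inv, inv_inv,
    mul_inv_cancel₀ (Real.sqrt_pos.2 h).ne']
  simp

lemma ofPlane_toPlane {x : ℂ} (hx : ‖x‖ < 1) : ofPlane (toPlane x) = x := by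
  have h : 0 < 1 - ‖x‖ ^ 2 := by
    have := norm_nonneg x
    nlinarith
  have h1 : 1 + ‖toPlane x‖ ^ 2 = (1 - ‖x‖ ^ 2)⁻¹ := by
    rw [toPlane, norm_mul, Complex.norm_real, mul_pow, Real.norm_eq_abs, sq_abs, inv_pow,
      Real.sq_sqrt h.le]
    field_simp
    ring
  rw [ofPlane, h1, toPlane, ← mul_assoc, ← Complex.ofReal_mul, Real.sqrt_inv, inv_inv,
    mul_inv_cancel₀ (Real.sqrt_pos.2 h).ne']
  simp

lemma continuous_ofPlane : Continuous ofPlane := by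
  refine Continuous.mul (Complex.continuous_ofReal.comp (Continuous.inv₀ (by fun_prop) fun y => ?_))
    continuous_id
  exact (Real.sqrt_pos.2 (by positivity)).ne'

/-- The planar coordinates of a configuration. -/
noncomputable def Conf.coord (c : Conf) (i : Fin 3) : ℂ := toPlane (c.1 i)

lemma Conf.coord_injective (c : Conf) : Function.Injective c.coord := fun i j h => by
  have h' := congrArg ofPlane h
  rw [Conf.coord, Conf.coord, ofPlane_toPlane (c.2.2 i), ofPlane_toPlane (c.2.2 j)] at h'
  exact c.2.1 (Subtype.ext h')

lemma Conf.continuous_planar (i : Fin 3) : Continuous fun c : Conf => c.coord i := by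
  refine Continuous.mul (Complex.continuous_ofReal.comp (Continuous.inv₀ ?_ fun c => ?_))
    (Conf.continuous_coord i)
  · have := Conf.continuous_coord i
    fun_prop
  · have := c.2.2 i
    have := norm_nonneg (c.1 i : ℂ)
    exact (Real.sqrt_pos.2 (by nlinarith)).ne'

/-- The configuration with given planar coordinates. -/
noncomputable def Conf.ofCoord (y : Fin 3 → ℂ) (hy : Function.Injective y) : Conf :=
  ⟨fun i => ⟨ofPlane (y i), mem_closedBall_zero_iff.2 (norm_ofPlane_lt _).le⟩, fun i j h => hy (by
    rw [← toPlane_ofPlane (y i), ← toPlane_ofPlane (y j)]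
    exact congrArg toPlane (congrArg Subtype.val h)), fun i => norm_ofPlane_lt _⟩

lemma Conf.ofCoord_coord (c : Conf) : Conf.ofCoord c.coord c.coord_injective = c :=
  Subtype.ext (funext fun i => Subtype.ext (ofPlane_toPlane (c.2.2 i)))

@[simp] lemma Conf.coord_ofCoord (y : Fin 3 → ℂ) (hy : Function.Injective y) :
    (Conf.ofCoord y hy).coord = y := funext fun i => toPlane_ofPlane (y i)

lemma Conf.ext_coord {c c' : Conf} (h : ∀ i, c.coord i = c'.coord i) : c = c' := by
  rw [← c.ofCoord_coord, ← c'.ofCoord_coord]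
  congr 1
  exact funext h

lemma Conf.continuous_ofCoord {Q : Type*} [TopologicalSpace Q] {y : Q → Fin 3 → ℂ}
    (hy : ∀ q, Function.Injective (y q)) (hc : Continuous y) :
    Continuous fun q => Conf.ofCoord (y q) (hy q) :=
  Continuous.subtype_mk (f := fun q i => (⟨ofPlane (y q i), _⟩ : Disc)) (continuous_pi fun i =>
    Continuous.subtype_mk (continuous_ofPlane.comp ((continuous_apply i).comp hc)) _) _

/-- The plane punctured at `0` and `1`. -/
def Punc : Type := {x : ℂ // x ≠ 0 ∧ x ≠ 1}

instance : TopologicalSpace Punc := inferInstanceAs (TopologicalSpace (Subtype _))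

/-- The difference of the first two points. -/
noncomputable def Conf.width (c : Conf) : ℂ := c.coord 1 - c.coord 0

lemma Conf.width_ne_zero (c : Conf) : c.width ≠ 0 :=
  sub_ne_zero.2 fun h => absurd (c.coord_injective h) (by decide)

lemma Conf.continuous_width : Continuous Conf.width :=
  (Conf.continuous_planar 1).sub (Conf.continuous_planar 0)

/-- The ratio of a configuration. -/
noncomputable def Conf.lam (c : Conf) : Punc :=
  ⟨(c.coord 2 - c.coord 0) / c.width, by
    refine ⟨div_ne_zero (sub_ne_zero.2 fun h => absurd (c.coord_injective h) (by decide))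
      c.width_ne_zero, fun h => ?_⟩
    rw [div_eq_one_iff_eq c.width_ne_zero, Conf.width, sub_left_inj] at h
    exact absurd (c.coord_injective h) (by decide)⟩

lemma Conf.continuous_lam : Continuous Conf.lam :=
  (((Conf.continuous_planar 2).sub (Conf.continuous_planar 0)).div Conf.continuous_width
    Conf.width_ne_zero).subtype_mk _

/-- Converse of the coordinates: any first point, nonzero width and admissible ratio do come from a
configuration. -/
lemma injective_of_ratio {a w x : ℂ} (hw : w ≠ 0) (hx : x ≠ 0 ∧ x ≠ 1) :
    Function.Injective ![a, a + w, a + w * x] := by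
  have h1 : w * x ≠ 0 := mul_ne_zero hw hx.1
  have h2 : w ≠ w * x := fun h => hx.2 (mul_left_cancel₀ hw (by rw [← h, mul_one]))
  intro i j h
  fin_cases i <;> fin_cases j <;> simp_all [eq_comm]

/-- Two paths of configurations are homotopic if the paths of ratios are homotopic and the widths
have the same winding. -/
theorem homotopic_of_lam {c c' : Conf} (p q : Path c c')
    (h : (p.map Conf.continuous_lam).Homotopic (q.map Conf.continuous_lam))
    (ℓ ℓ' : C(𝕀, ℂ)) (hℓ : ∀ t, Complex.exp (ℓ t) = (p t).width)
    (hℓ' : ∀ t, Complex.exp (ℓ' t) = (q t).width) (h0 : ℓ 0 = ℓ' 0) (h1 : ℓ 1 = ℓ' 1) :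
    p.Homotopic q := by
  obtain ⟨Λ⟩ := h
  -- First points are interpolated linearly, widths through their logarithms so as to stay nonzero,
  -- and ratios by the given homotopy.
  let a : 𝕀 × 𝕀 → ℂ := fun s => (1 - (s.1 : ℂ)) * (p s.2).coord 0 + s.1 * (q s.2).coord 0
  let w : 𝕀 × 𝕀 → ℂ := fun s => Complex.exp ((1 - (s.1 : ℂ)) * ℓ s.2 + s.1 * ℓ' s.2)
  have ha : Continuous a := by
    have h1 : Continuous fun t => (p t).coord 0 := (Conf.continuous_planar 0).comp p.continuous
    have h2 : Continuous fun t => (q t).coord 0 := (Conf.continuous_planar 0).comp q.continuous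
    have hs : Continuous fun s : 𝕀 × 𝕀 => ((s.1 : ℝ) : ℂ) := by fun_prop
    exact ((continuous_const.sub hs).mul (h1.comp continuous_snd)).add
      (hs.mul (h2.comp continuous_snd))
  have hw : Continuous w := by fun_prop
  have hΛ : Continuous fun s => (Λ s).1 := continuous_subtype_val.comp Λ.continuous
  let G : 𝕀 × 𝕀 → Conf := fun s => Conf.ofCoord ![a s, a s + w s, a s + w s * (Λ s).1]
    (injective_of_ratio (Complex.exp_ne_zero _) (Λ s).2)
  have hG : Continuous G := by
    refine Conf.continuous_ofCoord _ (continuous_pi fun i => ?_)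
    fin_cases i
    · exact ha
    · exact ha.add hw
    · exact ha.add (hw.mul hΛ)
  have key : ∀ (s : 𝕀 × 𝕀) (c : Conf), a s = c.coord 0 → w s = c.width → Λ s = c.lam →
      G s = c := by
    intro s c h1 h2 h3
    refine Conf.ext_coord fun i => ?_
    have h4 : w s * (Λ s).1 = c.coord 2 - c.coord 0 := by
      rw [h3, h2]
      exact mul_div_cancel₀ _ c.width_ne_zero
    simp only [G, Conf.coord_ofCoord]
    rw [h4, h1, h2]
    fin_cases i <;> simp [Conf.width]
  have hp1 : ∀ t, G (0, t) = p t := fun t => key _ _ (by simp [a]) (by simp [w, hℓ])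
    (Λ.map_zero_left t)
  have hq1 : ∀ t, G (1, t) = q t := fun t => key _ _ (by simp [a]) (by simp [w, hℓ'])
    (Λ.map_one_left t)
  have hs : ∀ s, G (s, 0) = c := fun s => key _ _ (by simp only [a, Path.source]; ring) (by
      have := hℓ 0
      rw [p.source] at this
      rw [← this]
      simp only [w, ← h0]
      congr 1
      ring) (Λ.source s)
  have ht : ∀ s, G (s, 1) = c' := fun s => key _ _ (by simp only [a, Path.target]; ring) (by
      have := hℓ 1
      rw [p.target] at this
      rw [← this]
      simp only [w, ← h1]
      congr 1
      ring) (Λ.target s)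
  exact ⟨{ toFun := G
           continuous_toFun := hG
           map_zero_left := hp1
           map_one_left := hq1
           prop' := by
            rintro s t (rfl | rfl)
            · change G (s, 0) = p 0
              rw [hs, p.source]
            · change G (s, 1) = p 1
              rw [ht, p.target] }⟩

/-! ### The punctured plane as a union of two contractible open sets -/

/-- The sign of a half plane. -/
def halfSign (b : Bool) : ℝ := if b then 1 else -1

lemma halfSign_mul_self (b : Bool) : halfSign b * halfSign b = 1 := by
  cases b <;> simp [halfSign]

/-- The complement of two vertical rays issuing from `0` and `1`, downwards if `b` is true and
upwards otherwise. -/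
def slit (b : Bool) : Set ℂ := {x | (x.re ≠ 0 ∧ x.re ≠ 1) ∨ 0 < halfSign b * x.im}

lemma isOpen_slit (b : Bool) : IsOpen (slit b) := by
  refine IsOpen.union (IsOpen.inter ?_ ?_) ?_
  · exact isOpen_ne_fun Complex.continuous_re continuous_const
  · exact isOpen_ne_fun Complex.continuous_re continuous_const
  · exact isOpen_lt continuous_const (continuous_const.mul Complex.continuous_im)

lemma mem_slit_of_nonneg {b : Bool} {x : ℂ} (h0 : x ≠ 0) (h1 : x ≠ 1)
    (h : 0 ≤ halfSign b * x.im) : x ∈ slit b := by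
  rcases h.eq_or_lt with h | h
  · have him : x.im = 0 := by
      have := congrArg (halfSign b * ·) h
      simpa [← mul_assoc, halfSign_mul_self] using this.symm
    exact Or.inl ⟨fun hr => h0 (Complex.ext hr him), fun hr => h1 (Complex.ext hr him)⟩
  · exact Or.inr h

lemma mem_slit_union {x : ℂ} (h0 : x ≠ 0) (h1 : x ≠ 1) : ∃ b, x ∈ slit b := by
  rcases le_total 0 x.im with h | h
  · exact ⟨true, mem_slit_of_nonneg h0 h1 (by simpa [halfSign] using h)⟩
  · exact ⟨false, mem_slit_of_nonneg h0 h1 (by simpa [halfSign] using h)⟩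

lemma ne_of_mem_slit {b : Bool} {x : ℂ} (hx : x ∈ slit b) : x ≠ 0 ∧ x ≠ 1 := by
  constructor <;> rintro rfl <;> simp [slit] at hx

lemma re_ne_of_mem_slit_inter {x : ℂ} {b : Bool} (h1 : x ∈ slit b) (h2 : x ∈ slit (!b)) :
    x.re ≠ 0 ∧ x.re ≠ 1 := by
  rcases h1 with h1 | h1
  · exact h1
  rcases h2 with h2 | h2
  · exact h2
  cases b <;> simp [halfSign] at h1 h2 <;> linarith

lemma halfSign_mul_im_add (b : Bool) (x : ℂ) (r : ℝ) :
    halfSign b * (x + (halfSign b * r : ℝ) * Complex.I).im = halfSign b * x.im + r := by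
  have h := halfSign_mul_self b
  simp only [Complex.add_im, Complex.mul_im, Complex.ofReal_re, Complex.ofReal_im,
    Complex.I_re, Complex.I_im, mul_one, mul_zero, add_zero]
  linear_combination r * h

lemma neg_abs_im_le (b : Bool) (x : ℂ) : -|x.im| ≤ halfSign b * x.im := by
  cases b
  · simpa [halfSign] using le_abs_self x.im
  · simpa [halfSign] using neg_abs_le x.im

/-- Vertical motion away from the two removed rays stays in the set and reaches height at least 1;
there a linear contraction to `halfSign b * I` is available. -/
instance contractibleSpace_slit (b : Bool) : ContractibleSpace (slit b) := by
  rw [contractible_iff_id_nullhomotopic]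
  have hf : ∀ x : ℂ, 1 ≤ halfSign b * (x + (halfSign b * (|x.im| + 1) : ℝ) * Complex.I).im := by
    intro x
    rw [halfSign_mul_im_add]
    linarith [neg_abs_im_le b x]
  let f : C(slit b, slit b) :=
    ⟨fun x => ⟨x + (halfSign b * (|x.1.im| + 1) : ℝ) * Complex.I,
      Or.inr (one_pos.trans_le (hf x))⟩, by fun_prop⟩
  have m1 : ∀ p : 𝕀 × slit b,
      p.2.1 + (halfSign b * (p.1 * (|p.2.1.im| + 1)) : ℝ) * Complex.I ∈ slit b := by
    intro p
    rcases p.2.2 with h | h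
    · exact Or.inl (by simpa using h)
    · refine Or.inr ?_
      rw [halfSign_mul_im_add]
      have : 0 ≤ (p.1 : ℝ) * (|p.2.1.im| + 1) := mul_nonneg p.1.2.1 (by positivity)
      linarith
  have h1 : (ContinuousMap.id (slit b)).Homotopic f :=
    ⟨⟨⟨fun p => ⟨_, m1 p⟩, by fun_prop⟩, fun x => Subtype.ext (by simp),
      fun x => Subtype.ext (by simp [f])⟩⟩
  have m2 : ∀ p : 𝕀 × slit b, ((1 - p.1 : ℝ) : ℂ) * f p.2 +
      (halfSign b * p.1 : ℝ) * Complex.I ∈ slit b := by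
    intro p
    refine Or.inr ?_
    rw [halfSign_mul_im_add, Complex.im_ofReal_mul]
    have h2 : 1 ≤ halfSign b * (f p.2).1.im := hf p.2
    have h3 := p.1.2.1
    have h4 := p.1.2.2
    nlinarith
  have hpt : (halfSign b : ℂ) * Complex.I ∈ slit b := Or.inr (by
    rw [Complex.im_ofReal_mul, Complex.I_im, mul_one, halfSign_mul_self]
    exact one_pos)
  exact ⟨⟨_, hpt⟩, h1.trans ⟨⟨⟨fun p => ⟨_, m2 p⟩, by fun_prop⟩, fun x => Subtype.ext (by simp),
    fun x => Subtype.ext (by simp)⟩⟩⟩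

/-- Paths in a slit plane with the same endpoints are homotopic in the punctured plane. -/
lemma homotopic_of_slit {b : Bool} {x y : Punc} {p q : Path x y} (hp : ∀ t, (p t).1 ∈ slit b)
    (hq : ∀ t, (q t).1 ∈ slit b) : p.Homotopic q := by
  have hx : x.1 ∈ slit b := by simpa using hp 0
  have hy : y.1 ∈ slit b := by simpa using hp 1
  let lift (r : Path x y) (hr : ∀ t, (r t).1 ∈ slit b) :
      Path (⟨x.1, hx⟩ : slit b) ⟨y.1, hy⟩ :=
    ⟨⟨fun t => ⟨(r t).1, hr t⟩, (continuous_subtype_val.comp r.continuous).subtype_mk _⟩,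
      Subtype.ext (by simp), Subtype.ext (by simp)⟩
  have h : (lift p hp).Homotopic (lift q hq) := SimplyConnectedSpace.paths_homotopic _ _
  exact h.map ⟨fun x : slit b => (⟨x.1, ne_of_mem_slit x.2⟩ : Punc),
    continuous_subtype_val.subtype_mk _⟩

/-- The index of the component of the intersection of the two slit planes: `0` is `1 < re x`, `1`
is `re x < 0`, `2` is `0 < re x < 1`. -/
noncomputable def strip (x : ℂ) : Fin 3 := if x.re < 0 then 1 else if x.re < 1 then 2 else 0

/-- Local constancy of the strip is what makes the coordinate changes of the twisted covering
continuous. -/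
lemma strip_eventually_eq {x : ℂ} (hx : x.re ≠ 0 ∧ x.re ≠ 1) :
    ∀ᶠ y in nhds x, strip y = strip x := by
  have hc := Complex.continuous_re.continuousAt (x := x)
  rcases lt_or_gt_of_ne hx.1 with h0 | h0
  · filter_upwards [hc.eventually_lt continuousAt_const h0] with y hy
    simp only [strip, hy, h0, if_true]
  rcases lt_or_gt_of_ne hx.2 with h1 | h1
  · filter_upwards [hc.eventually_lt continuousAt_const h1,
      continuousAt_const.eventually_lt hc h0] with y hy hy'
    simp only [strip, hy, hy'.not_gt, h0.not_gt, h1, if_true, if_false]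
  · filter_upwards [continuousAt_const.eventually_lt hc h1,
      continuousAt_const.eventually_lt hc h0] with y hy hy'
    simp only [strip, hy.not_gt, hy'.not_gt, h0.not_gt, h1.not_gt, if_false]

/-- Points of the same strip are joined by a path in the intersection of the slit planes. -/
lemma exists_path_strip {x y : Punc} (hx : x.1.re ≠ 0 ∧ x.1.re ≠ 1) (hy : y.1.re ≠ 0 ∧ y.1.re ≠ 1)
    (h : strip x.1 = strip y.1) : ∃ p : Path x y, ∀ t, (p t).1.re ≠ 0 ∧ (p t).1.re ≠ 1 := by
  let f : 𝕀 → ℂ := fun t => ((1 - t : ℝ) : ℂ) * x.1 + ((t : ℝ) : ℂ) * y.1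
  have hf : ∀ t, (f t).re ≠ 0 ∧ (f t).re ≠ 1 := by
    intro t
    have hr : (f t).re = (1 - t) * x.1.re + t * y.1.re := by
      simp [f]
    have h0 := t.2.1
    have h1 := t.2.2
    rw [hr]
    set u := x.1.re
    set v := y.1.re
    have hcvx : ∀ c : ℝ, (u < c → v < c → (1 - t) * u + t * v < c) ∧
        (c < u → c < v → c < (1 - t) * u + t * v) := by
      intro c
      refine ⟨fun h2 h3 => ?_, fun h2 h3 => ?_⟩
      · rcases h0.eq_or_lt with h4 | h4
        · rw [← h4]; linarith
        · nlinarith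
      · rcases h0.eq_or_lt with h4 | h4
        · rw [← h4]; linarith
        · nlinarith
    have hsx : strip x.1 = if u < 0 then 1 else if u < 1 then 2 else 0 := rfl
    have hsy : strip y.1 = if v < 0 then 1 else if v < 1 then 2 else 0 := rfl
    have key : (u < 0 ∧ v < 0) ∨ (0 < u ∧ 0 < v ∧ u < 1 ∧ v < 1) ∨ (1 < u ∧ 1 < v) := by
      rw [hsx, hsy] at h
      rcases lt_or_gt_of_ne hx.1 with a1 | a1 <;> rcases lt_or_gt_of_ne hy.1 with a2 | a2 <;>
        rcases lt_or_gt_of_ne hx.2 with a3 | a3 <;> rcases lt_or_gt_of_ne hy.2 with a4 | a4 <;>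
        simp [a1, a2, a3, a4, a1.not_gt, a2.not_gt, a3.not_gt, a4.not_gt] at h ⊢
    rcases key with ⟨h2, h3⟩ | ⟨h2, h3, h4, h5⟩ | ⟨h2, h3⟩
    · have := (hcvx 0).1 h2 h3
      exact ⟨by linarith, by linarith⟩
    · exact ⟨((hcvx 0).2 h2 h3).ne', ((hcvx 1).1 h4 h5).ne⟩
    · have := (hcvx 1).2 h2 h3
      exact ⟨by linarith, by linarith⟩
  have hf' : ∀ t, f t ≠ 0 ∧ f t ≠ 1 := fun t =>
    ⟨fun h => (hf t).1 (by rw [h]; rfl), fun h => (hf t).2 (by rw [h]; rfl)⟩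
  exact ⟨⟨⟨fun t => ⟨f t, hf' t⟩, by fun_prop⟩, Subtype.ext (by simp [f]),
    Subtype.ext (by simp [f])⟩, hf⟩

/-! ### A covering of the punctured plane -/

section Covering
variable {G : Type*} [Group G] [TopologicalSpace G] [DiscreteTopology G] (tw : Fin 3 → G)

/-- The coordinate changes of the covering of the punctured plane with fibre `G` twisted by `tw` on
the three strips. -/
noncomputable def stripChange : Bool → Bool → ℂ → G
  | true, false, x => tw (strip x)
  | false, true, x => (tw (strip x))⁻¹
  | _, _, _ => 1

/-- The covering of the punctured plane with fibre `G` twisted by `tw` on the three strips. -/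
noncomputable def stripCore : FiberBundleCore Bool Punc G where
  baseSet b := {x | x.1 ∈ slit b}
  isOpen_baseSet b := (isOpen_slit b).preimage continuous_subtype_val
  -- The chart `true` is preferred on the overlap, so labels over a strip are always read in it;
  -- `transport_of_slit` depends on this choice.
  indexAt x := @ite _ (x.1 ∈ slit true) (Classical.dec _) true false
  mem_baseSet_at x := by
    split_ifs with h
    · exact h
    · obtain ⟨b, hb⟩ := mem_slit_union x.2.1 x.2.2
      cases b
      · exact hb
      · exact absurd hb h
  coordChange i j x g := stripChange tw i j x.1 * g
  coordChange_self i x _ g := by cases i <;> simp [stripChange]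
  continuousOn_coordChange i j := by
    rintro ⟨x, g⟩ ⟨hx, -⟩
    refine ContinuousAt.continuousWithinAt ?_
    have hc : ContinuousAt (fun p : Punc × G => stripChange tw i j p.1.1) (x, g) := by
      by_cases hij : i = j
      · subst hij
        cases i <;> exact continuousAt_const
      · have hij' : j = !i := by cases i <;> cases j <;> simp_all
        subst hij'
        have h1 := strip_eventually_eq (re_ne_of_mem_slit_inter hx.1 hx.2)
        have h2 : Filter.Tendsto (fun p : Punc × G => p.1.1) (nhds (x, g)) (nhds x.1) :=
          (continuous_subtype_val.comp continuous_fst).tendsto _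
        refine (continuousAt_const (y := stripChange tw i (!i) x.1)).congr ?_
        filter_upwards [h2.eventually h1] with p hp
        cases i <;> simp only [stripChange, hp, Bool.not_true, Bool.not_false]
    exact ContinuousAt.comp (g := fun p : G × G => p.1 * p.2)
      continuous_of_discreteTopology.continuousAt (hc.prodMk continuousAt_snd)
  coordChange_comp i j k x _ g := by
    cases i <;> cases j <;> cases k <;> simp [stripChange]

lemma isCoveringMap_stripCore : IsCoveringMap (stripCore tw).proj :=
  FiberBundle.isCoveringMap (F := G) (E := (stripCore tw).Fiber)

/-- The transport of the covering along a path. -/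
noncomputable def transport {x y : Punc} (γ : Path x y) (g : G) : G :=
  ((isCoveringMap_stripCore tw).monodromy (.mk γ)
    ⟨(⟨x, g⟩ : (stripCore tw).TotalSpace), rfl⟩).1.2

lemma transport_congr {x y : Punc} {γ γ' : Path x y} (h : γ.Homotopic γ') :
    transport tw γ = transport tw γ' := by
  unfold transport
  rw [Path.Homotopic.Quotient.eq.2 h]

lemma transport_trans {x y w : Punc} (γ : Path x y) (γ' : Path y w) (g : G) :
    transport tw (γ.trans γ') g = transport tw γ' (transport tw γ g) := by
  unfold transport
  rw [Path.Homotopic.Quotient.mk_trans, IsCoveringMap.monodromy_trans_apply]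
  obtain ⟨⟨y', k⟩, hy⟩ := (isCoveringMap_stripCore tw).monodromy (.mk γ)
    ⟨(⟨x, g⟩ : (stripCore tw).TotalSpace), rfl⟩
  obtain rfl : y' = y := hy
  rfl

lemma transport_refl (x : Punc) (g : G) : transport tw (Path.refl x) g = g := by
  unfold transport
  rw [Path.Homotopic.Quotient.mk_refl, IsCoveringMap.monodromy_refl]
  rfl

/-- In chart `b` the lift has a constant label. The two factors convert from chart `true` to `b` at
the start and back at the end. -/
lemma transport_of_slit {b : Bool} {x y : Punc} {γ : Path x y} (hγ : ∀ t, (γ t).1 ∈ slit b)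
    (hx : x.1 ∈ slit true) (hy : y.1 ∈ slit true) (g : G) :
    transport tw γ g = stripChange tw b true y.1 * (stripChange tw true b x.1 * g) := by
  let k : G := stripChange tw true b x.1 * g
  have hxb : x.1 ∈ slit b := by simpa using hγ 0
  have hix : (stripCore tw).indexAt x = true := if_pos hx
  have hiy : (stripCore tw).indexAt y = true := if_pos hy
  let T := (stripCore tw).localTriv b
  have hT : ∀ t, (γ t, k) ∈ T.target := fun t => ⟨hγ t, trivial⟩
  let Γ : Path (T.toOpenPartialHomeomorph.symm (x, k)) (T.toOpenPartialHomeomorph.symm (y, k)) :=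
    { toFun := fun t => T.toOpenPartialHomeomorph.symm (γ t, k)
      continuous_toFun := T.toOpenPartialHomeomorph.symm.continuousOn.comp_continuous
        (by fun_prop) hT
      source' := by simp
      target' := by simp }
  have e1 : T.toOpenPartialHomeomorph.symm (x, k) = (⟨x, g⟩ : (stripCore tw).TotalSpace) := by
    change (⟨x, (stripCore tw).coordChange b ((stripCore tw).indexAt x) x k⟩ :
      (stripCore tw).TotalSpace) = _
    rw [hix]
    congr 1
    change stripChange tw b true x.1 * (stripChange tw true b x.1 * g) = g
    cases b <;> simp [stripChange]
  have e2 : T.toOpenPartialHomeomorph.symm (y, k) = (⟨y, stripChange tw b true y.1 * k⟩ :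
      (stripCore tw).TotalSpace) := by
    change (⟨y, (stripCore tw).coordChange b ((stripCore tw).indexAt y) y k⟩ :
      (stripCore tw).TotalSpace) = _
    rw [hiy]
    rfl
  have key := (isCoveringMap_stripCore tw).monodromy_eq_of_map_eq (γ := .mk γ)
    (ex := ⟨(⟨x, g⟩ : (stripCore tw).TotalSpace), rfl⟩)
    (ey := ⟨(⟨y, stripChange tw b true y.1 * k⟩ : (stripCore tw).TotalSpace), rfl⟩)
    (.mk (Γ.cast e1.symm e2.symm)) ?_
  · unfold transport
    rw [key]
  · refine congrArg Path.Homotopic.Quotient.mk ?_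
    ext t
    rfl

end Covering

/-! ### Twist rotations -/

/-- A smooth profile equal to `1` on `s ≤ 9 / 16` and to `0` on `1 ≤ s`. -/
noncomputable def profile (s : ℝ) : ℝ := Real.smoothTransition ((1 - s) * (16 / 7))

lemma profile_of_le {s : ℝ} (hs : s ≤ 9 / 16) : profile s = 1 :=
  Real.smoothTransition.one_of_one_le (by linarith)

lemma profile_of_ge {s : ℝ} (hs : 1 ≤ s) : profile s = 0 :=
  Real.smoothTransition.zero_of_nonpos (by linarith)

lemma contDiff_profile : ContDiff ℝ ∞ profile :=
  Real.smoothTransition.contDiff.comp (by fun_prop)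

/-- The rotation of the plane by the angle `θ`, damped out near the unit circle. -/
noncomputable def twistFun (θ : ℝ) (x : ℂ) : ℂ :=
  Complex.exp ((θ * profile (‖x‖ ^ 2) : ℝ) * Complex.I) * x

lemma norm_twistFun (θ : ℝ) (x : ℂ) : ‖twistFun θ x‖ = ‖x‖ := by
  rw [twistFun, norm_mul, Complex.norm_exp_ofReal_mul_I, one_mul]

/-- The angle depends only on the norm, which the map preserves, so the damped rotations form a
one-parameter group. -/
lemma twistFun_add (θ θ' : ℝ) (x : ℂ) : twistFun (θ + θ') x = twistFun θ (twistFun θ' x) := by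
  rw [twistFun, twistFun, norm_twistFun, twistFun, ← mul_assoc, ← Complex.exp_add]
  congr 2
  push_cast
  ring

lemma twistFun_zero (x : ℂ) : twistFun 0 x = x := by simp [twistFun]

lemma twistFun_of_le (θ : ℝ) {x : ℂ} (hx : ‖x‖ ≤ 3 / 4) :
    twistFun θ x = Complex.exp (θ * Complex.I) * x := by
  have := norm_nonneg x
  -- The threshold 9/16 of `profile` is the square of 3/4.
  rw [twistFun, profile_of_le (by nlinarith), mul_one]

lemma twistFun_of_ge (θ : ℝ) {x : ℂ} (hx : 1 ≤ ‖x‖) : twistFun θ x = x := by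
  rw [twistFun, profile_of_ge (by nlinarith)]
  simp

lemma contDiff_twistFun (θ : ℝ) : ContDiff ℝ ∞ (twistFun θ) := by
  have h1 : ContDiff ℝ ∞ fun x : ℂ => θ * profile (‖x‖ ^ 2) :=
    contDiff_const.mul (contDiff_profile.comp (contDiff_norm_sq ℝ))
  have h2 : ContDiff ℝ ∞ fun x : ℂ => ((θ * profile (‖x‖ ^ 2) : ℝ) : ℂ) :=
    Complex.ofRealCLM.contDiff.comp h1
  exact ((h2.mul contDiff_const).cexp).mul contDiff_id

lemma continuous_twistFun : Continuous fun p : ℝ × ℂ => twistFun p.1 p.2 := by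
  have := contDiff_profile.continuous
  unfold twistFun
  fun_prop

/-- The damped rotation of the disc. -/
noncomputable def twist (θ : ℝ) : bdryFix :=
  ⟨{  toFun := fun x => ⟨twistFun θ x, by
        rw [mem_closedBall_zero_iff, norm_twistFun]; exact x.norm_le⟩
      invFun := fun x => ⟨twistFun (-θ) x, by
        rw [mem_closedBall_zero_iff, norm_twistFun]; exact x.norm_le⟩
      left_inv := fun x => Subtype.ext <| by
        change twistFun (-θ) (twistFun θ x) = x
        rw [← twistFun_add, neg_add_cancel, twistFun_zero]
      right_inv := fun x => Subtype.ext <| by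
        change twistFun θ (twistFun (-θ) x) = x
        rw [← twistFun_add, add_neg_cancel, twistFun_zero]
      continuous_toFun := ((contDiff_twistFun θ).continuous.comp continuous_subtype_val).subtype_mk _
      continuous_invFun :=
        ((contDiff_twistFun (-θ)).continuous.comp continuous_subtype_val).subtype_mk _ },
    fun x hx => Subtype.ext (twistFun_of_ge θ hx.ge)⟩

lemma coe_twist (θ : ℝ) (x : Disc) : ((twist θ).1 x : ℂ) = twistFun θ x := rfl

lemma twist_add (θ θ' : ℝ) : twist (θ + θ') = twist θ * twist θ' :=
  alex_ext fun x => Subtype.ext (twistFun_add θ θ' x)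

@[simp] lemma twist_zero : twist 0 = 1 := alex_ext fun x => Subtype.ext (twistFun_zero x)

lemma isDiffeo_twist (θ : ℝ) : IsDiffeo (twist θ).1 :=
  ⟨⟨twistFun θ, (contDiff_twistFun θ).contDiffOn, fun _ => rfl⟩,
    ⟨twistFun (-θ), (contDiff_twistFun (-θ)).contDiffOn, fun _ => rfl⟩⟩

lemma contFam_twist : ContFam fun θ : ℝ => (twist θ).1 :=
  (continuous_twistFun.comp (continuous_id.prodMap continuous_subtype_val)).subtype_mk _

lemma twist_two_pi_apply {x : Disc} (hx : ‖(x : ℂ)‖ ≤ 3 / 4) : (twist (2 * Real.pi)).1 x = x := by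
  refine Subtype.ext ?_
  rw [coe_twist, twistFun_of_le _ hx]
  push_cast
  rw [Complex.exp_two_pi_mul_I, one_mul]

lemma toPlane_rotate (θ : ℝ) (x : ℂ) :
    toPlane (Complex.exp (θ * Complex.I) * x) = Complex.exp (θ * Complex.I) * toPlane x := by
  rw [toPlane, toPlane, norm_mul, Complex.norm_exp_ofReal_mul_I, one_mul]
  ring

/-- A configuration contained in the region that is rotated rigidly. -/
def Conf.Small (c : Conf) : Prop := ∀ i, ‖(c.1 i : ℂ)‖ ≤ 3 / 4

lemma Conf.Small.perm {c : Conf} (hc : c.Small) (σ : Equiv.Perm (Fin 3)) : (c.perm σ).Small :=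
  fun i => hc (σ i)

lemma Conf.Small.coord_twist {c : Conf} (hc : c.Small) (θ : ℝ) (i : Fin 3) :
    (act (twist θ) c).coord i = Complex.exp (θ * Complex.I) * c.coord i := by
  rw [Conf.coord, Conf.coord, ← toPlane_rotate]
  congr 1
  exact twistFun_of_le θ (hc i)

lemma Conf.Small.width_twist {c : Conf} (hc : c.Small) (θ : ℝ) :
    (act (twist θ) c).width = Complex.exp (θ * Complex.I) * c.width := by
  rw [Conf.width, hc.coord_twist, hc.coord_twist, Conf.width, mul_sub]

/-- A rigid rotation multiplies numerator and denominator of the ratio by the same factor; rotations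
are seen only by the width. -/
lemma Conf.Small.lam_twist {c : Conf} (hc : c.Small) (θ : ℝ) :
    (act (twist θ) c).lam = c.lam := by
  refine Subtype.ext ?_
  change ((act (twist θ) c).coord 2 - (act (twist θ) c).coord 0) / (act (twist θ) c).width = _
  rw [hc.width_twist, hc.coord_twist, hc.coord_twist, ← mul_sub,
    mul_div_mul_left _ _ (Complex.exp_ne_zero _)]
  rfl

/-- The path of configurations traced by a damped rotation. -/
noncomputable def twistPath (θ : ℝ) (c : Conf) : Path c (act (twist θ) c) where
  toFun t := act (twist (θ * t)) c
  continuous_toFun := continuous_act contFam_twist (by fun_prop) continuous_const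
  source' := by simp
  target' := by simp

lemma pathAt_twist (θ : ℝ) (c : Conf) : (pathAt (twist θ) c).Homotopic (twistPath θ c) :=
  pathAt_homotopic_of_isotopy (h := fun t => twist (θ * t)) (contFam_twist.comp (by fun_prop))
    (by simp) (by simp) (twistPath θ c) (fun _ => rfl) rfl

/-! ### Orientation of triangles -/

/-- The parity of a permutation. -/
def isEven (σ : Equiv.Perm (Fin 3)) : Bool := decide (Equiv.Perm.sign σ = 1)

/-- The cyclic permutation `0 → 1 → 2 → 0`. -/
def cyc : Equiv.Perm (Fin 3) := finRotate 3

/-- The transposition of `0` and `2`. -/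
def swapEnds : Equiv.Perm (Fin 3) := Equiv.swap 0 2

lemma perm_cases : ∀ σ : Equiv.Perm (Fin 3), σ = 1 ∨ σ = cyc ∨ σ = cyc ^ 2 ∨ σ = swapEnds ∨
    σ = swapEnds * cyc ∨ σ = swapEnds * cyc ^ 2 := by decide

lemma isEven_cyc_mul : ∀ σ, isEven (cyc * σ) = isEven σ := by decide

lemma Conf.perm_perm (c : Conf) (σ τ : Equiv.Perm (Fin 3)) :
    (c.perm σ).perm τ = c.perm (σ * τ) := rfl

/-- Twice the signed area of the triangle spanned by a configuration. -/
noncomputable def Conf.area (c : Conf) : ℝ :=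
  (c.coord 2 - c.coord 0).im * (c.coord 1 - c.coord 0).re -
    (c.coord 2 - c.coord 0).re * (c.coord 1 - c.coord 0).im

lemma Conf.area_perm (c : Conf) (σ : Equiv.Perm (Fin 3)) :
    (c.perm σ).area = halfSign (isEven σ) * c.area := by
  have h : ∀ τ : Equiv.Perm (Fin 3), ∀ i j k : Fin 3, τ 0 = i → τ 1 = j → τ 2 = k →
      (c.perm τ).area = (c.coord k - c.coord i).im * (c.coord j - c.coord i).re -
        (c.coord k - c.coord i).re * (c.coord j - c.coord i).im := by
    rintro τ i j k rfl rfl rfl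
    rfl
  rcases perm_cases σ with rfl | rfl | rfl | rfl | rfl | rfl
  · rw [h _ 0 1 2 (by decide) (by decide) (by decide), show isEven 1 = true by decide]
    simp only [halfSign, Conf.area, Complex.sub_re, Complex.sub_im, if_true]; ring
  · rw [h _ 1 2 0 (by decide) (by decide) (by decide), show isEven cyc = true by decide]
    simp only [halfSign, Conf.area, Complex.sub_re, Complex.sub_im, if_true]; ring
  · rw [h _ 2 0 1 (by decide) (by decide) (by decide), show isEven (cyc ^ 2) = true by decide]
    simp only [halfSign, Conf.area, Complex.sub_re, Complex.sub_im, if_true]; ring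
  · rw [h _ 2 1 0 (by decide) (by decide) (by decide), show isEven swapEnds = false by decide]
    simp only [halfSign, Conf.area, Complex.sub_re, Complex.sub_im]; norm_num; ring
  · rw [h _ 1 0 2 (by decide) (by decide) (by decide), show isEven (swapEnds * cyc) = false by decide]
    simp only [halfSign, Conf.area, Complex.sub_re, Complex.sub_im]; norm_num; ring
  · rw [h _ 0 2 1 (by decide) (by decide) (by decide),
      show isEven (swapEnds * cyc ^ 2) = false by decide]
    simp only [halfSign, Conf.area, Complex.sub_re, Complex.sub_im]; norm_num; ring

lemma Conf.im_lam (c : Conf) : c.lam.1.im = c.area / Complex.normSq c.width := by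
  change ((c.coord 2 - c.coord 0) / c.width).im = _
  rw [Complex.div_im, Conf.area, Conf.width]
  ring

/-- The imaginary part of the ratio has the sign of the oriented area, and a reordering changes that
sign by its parity. The closed half plane minus `0` and `1` lies in the slit plane. -/
lemma Conf.lam_perm_mem_slit {c : Conf} (hc : 0 ≤ c.area) (σ : Equiv.Perm (Fin 3)) :
    (c.perm σ).lam.1 ∈ slit (isEven σ) := by
  refine mem_slit_of_nonneg (c.perm σ).lam.2.1 (c.perm σ).lam.2.2 ?_
  rw [Conf.im_lam, Conf.area_perm, mul_div_assoc, ← mul_assoc, halfSign_mul_self, one_mul]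
  exact div_nonneg hc (Complex.normSq_nonneg _)

lemma Conf.area_nonneg_iff (c : Conf) : 0 ≤ c.area ↔ 0 ≤ c.lam.1.im := by
  have h : 0 < Complex.normSq c.width := Complex.normSq_pos.2 c.width_ne_zero
  rw [Conf.im_lam, le_div_iff₀ h, zero_mul]

/-! ### The standard configurations -/

/-- Three points on a vertical line (at time `0`) moving to an equilateral triangle (at time `1`). -/
noncomputable def etaFun (t : ℝ) : Fin 3 → ℂ :=
  ![⟨-t / 4, -(√3 / 4)⟩, ⟨t / 2, 0⟩, ⟨-t / 4, √3 / 4⟩]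

lemma norm_etaFun_le {t : ℝ} (h0 : 0 ≤ t) (h1 : t ≤ 1) (i : Fin 3) : ‖etaFun t i‖ ≤ 1 / 2 := by
  have h3 : √3 * √3 = 3 := Real.mul_self_sqrt (by norm_num)
  rw [← sq_le_sq₀ (norm_nonneg _) (by norm_num), Complex.sq_norm, Complex.normSq_apply]
  fin_cases i <;> simp [etaFun] <;> nlinarith

lemma etaFun_injective (t : ℝ) : Function.Injective (etaFun t) := by
  have h3 : 0 < √3 := by positivity
  intro i j h
  have h' := congrArg Complex.im h
  fin_cases i <;> fin_cases j <;> simp [etaFun] at h' ⊢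
  all_goals linarith

/-- The path from the vertical configuration to the triangle. -/
noncomputable def eta (t : 𝕀) : Conf :=
  ⟨fun i => ⟨etaFun t i, mem_closedBall_zero_iff.2
      ((norm_etaFun_le t.2.1 t.2.2 i).trans (by norm_num))⟩,
    fun i j h => etaFun_injective t (congrArg Subtype.val h),
    fun i => (norm_etaFun_le t.2.1 t.2.2 i).trans_lt (by norm_num)⟩

lemma continuous_etaFun : Continuous etaFun := by
  have h : ∀ r s : ℝ → ℝ, Continuous r → Continuous s →
      Continuous fun t => (⟨r t, s t⟩ : ℂ) := fun r s hr hs =>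
    Complex.equivRealProdCLM.symm.continuous.comp (hr.prodMk hs)
  refine continuous_pi fun i => ?_
  fin_cases i
  · exact h _ _ (by fun_prop) (by fun_prop)
  · exact h _ _ (by fun_prop) (by fun_prop)
  · exact h _ _ (by fun_prop) (by fun_prop)

lemma continuous_eta : Continuous eta :=
  Continuous.subtype_mk (f := fun (t : 𝕀) i => (⟨etaFun t i, _⟩ : Disc))
    (continuous_pi fun i => ((continuous_apply i).comp
      (continuous_etaFun.comp continuous_subtype_val)).subtype_mk _) _

lemma small_eta (t : 𝕀) : (eta t).Small := fun i =>
  (norm_etaFun_le t.2.1 t.2.2 i).trans (by norm_num)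

/-- The base configuration. -/
noncomputable abbrev baseConf : Conf := eta 0

lemma exists_coord_eta (t : 𝕀) : ∃ m > 0, ∃ m' > 0, (eta t).coord 0 = ⟨-m * t, -(m * √3)⟩ ∧
    (eta t).coord 1 = ⟨m' * t, 0⟩ ∧ (eta t).coord 2 = ⟨-m * t, m * √3⟩ := by
  have hpos : ∀ i, 0 < (√(1 - ‖etaFun t i‖ ^ 2))⁻¹ := by
    intro i
    have := norm_etaFun_le t.2.1 t.2.2 i
    have := norm_nonneg (etaFun t i)
    exact inv_pos.2 (Real.sqrt_pos.2 (by nlinarith))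
  -- The outer two points have equal norm, so the radial chart scales them by the same factor.
  have hn : ‖etaFun t 2‖ = ‖etaFun t 0‖ := by
    rw [← sq_eq_sq₀ (norm_nonneg _) (norm_nonneg _), Complex.sq_norm, Complex.sq_norm,
      Complex.normSq_apply, Complex.normSq_apply]
    simp [etaFun]
  refine ⟨_, div_pos (hpos 0) (by norm_num : (0 : ℝ) < 4), _,
    div_pos (hpos 1) (by norm_num : (0 : ℝ) < 2), ?_, ?_, ?_⟩
  · change toPlane (etaFun t 0) = _
    rw [toPlane]
    refine Complex.ext ?_ ?_ <;> rw [etaFun] <;> simp <;> ring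
  · change toPlane (etaFun t 1) = _
    rw [toPlane]
    refine Complex.ext ?_ ?_ <;> rw [etaFun] <;> simp
    ring
  · change toPlane (etaFun t 2) = _
    rw [toPlane, hn]
    refine Complex.ext ?_ ?_ <;> rw [etaFun] <;> simp <;> ring

lemma area_eta_nonneg (t : 𝕀) : 0 ≤ (eta t).area := by
  obtain ⟨m, hm, m', hm', h0, h1, h2⟩ := exists_coord_eta t
  have h3 : 0 < √3 := by positivity
  have ht := t.2.1
  rw [Conf.area, h0, h1, h2]
  simp only [Complex.sub_re, Complex.sub_im]
  have : 0 ≤ (m * √3) * (m' * t + m * t) := by positivity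
  linarith

/-- The base coordinates are `-u, 0, u`; the cyclic orders give one ratio in each of the three
strips. -/
lemma lam_base : (baseConf.lam.1 = 2 ∧ (baseConf.perm cyc).lam.1 = -1) ∧
    (baseConf.perm (cyc ^ 2)).lam.1 = 1 / 2 := by
  obtain ⟨m, hm, m', hm', h0, h1, h2⟩ := exists_coord_eta 0
  have h3 : 0 < √3 := by positivity
  simp only [Set.Icc.coe_zero, mul_zero] at h0 h1 h2
  have e0 : baseConf.coord 0 = -((m * √3 : ℝ) * Complex.I) := by
    rw [h0]; apply Complex.ext <;> simp
  have e1 : baseConf.coord 1 = 0 := by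
    rw [h1]; apply Complex.ext <;> simp
  have e2 : baseConf.coord 2 = (m * √3 : ℝ) * Complex.I := by
    rw [h2]; apply Complex.ext <;> simp
  have hu : ((m * √3 : ℝ) : ℂ) * Complex.I ≠ 0 :=
    mul_ne_zero (by exact_mod_cast (mul_pos hm h3).ne') Complex.I_ne_zero
  set u := ((m * √3 : ℝ) : ℂ) * Complex.I
  refine ⟨⟨?_, ?_⟩, ?_⟩
  · change (baseConf.coord 2 - baseConf.coord 0) / (baseConf.coord 1 - baseConf.coord 0) = _
    rw [e0, e1, e2, div_eq_iff (by simpa [← two_mul, sub_eq_add_neg, ← neg_add] using hu)]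
    ring
  · change (baseConf.coord 0 - baseConf.coord 1) / (baseConf.coord 2 - baseConf.coord 1) = _
    rw [e0, e1, e2, div_eq_iff (by simpa [← two_mul, sub_eq_add_neg, ← neg_add] using hu)]
    ring
  · change (baseConf.coord 1 - baseConf.coord 2) / (baseConf.coord 0 - baseConf.coord 2) = _
    rw [e0, e1, e2, div_eq_iff (by simpa [← two_mul, sub_eq_add_neg, ← neg_add] using hu)]
    ring

lemma act_halfTurn_base : act (twist Real.pi) baseConf = baseConf.perm swapEnds := by
  refine Subtype.ext (funext fun i => Subtype.ext ?_)
  change twistFun Real.pi (etaFun (0 : 𝕀) i) = etaFun (0 : 𝕀) (swapEnds i)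
  have hle : ‖etaFun (0 : 𝕀) i‖ ≤ 3 / 4 := small_eta 0 i
  rw [twistFun_of_le _ hle, Complex.exp_pi_mul_I]
  have h : swapEnds 0 = 2 ∧ swapEnds 1 = 1 ∧ swapEnds 2 = 0 := by decide
  fin_cases i
  · change -1 * _ = etaFun _ (swapEnds 0)
    rw [h.1]
    simp [etaFun, Complex.ext_iff]
  · change -1 * _ = etaFun _ (swapEnds 1)
    rw [h.2.1]
    simp [etaFun, Complex.ext_iff]
  · change -1 * _ = etaFun _ (swapEnds 2)
    rw [h.2.2]
    simp [etaFun, Complex.ext_iff]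

lemma act_thirdTurn_triangle : act (twist (2 * Real.pi / 3)) (eta 1) = (eta 1).perm cyc := by
  refine Subtype.ext (funext fun i => Subtype.ext ?_)
  change twistFun (2 * Real.pi / 3) (etaFun (1 : 𝕀) i) = etaFun (1 : 𝕀) (cyc i)
  have hs : Complex.exp ((2 * Real.pi / 3 : ℝ) * Complex.I) = ⟨-1 / 2, √3 / 2⟩ := by
    have e : 2 * Real.pi / 3 = Real.pi - Real.pi / 3 := by ring
    apply Complex.ext
    · rw [Complex.exp_ofReal_mul_I_re, e, Real.cos_pi_sub, Real.cos_pi_div_three]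
      norm_num
    · rw [Complex.exp_ofReal_mul_I_im, e, Real.sin_pi_sub, Real.sin_pi_div_three]
  have h3 : √3 * √3 = 3 := Real.mul_self_sqrt (by norm_num)
  have hle : ‖etaFun (1 : 𝕀) i‖ ≤ 3 / 4 := small_eta 1 i
  rw [twistFun_of_le _ hle, hs]
  have h : cyc 0 = 1 ∧ cyc 1 = 2 ∧ cyc 2 = 0 := by decide
  fin_cases i
  · change _ * etaFun _ 0 = etaFun _ (cyc 0)
    rw [h.1]
    simp [etaFun, Complex.ext_iff]
    constructor <;> linarith
  · change _ * etaFun _ 1 = etaFun _ (cyc 1)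
    rw [h.2.1]
    simp [etaFun, Complex.ext_iff]
    constructor <;> linarith
  · change _ * etaFun _ 2 = etaFun _ (cyc 2)
    rw [h.2.2]
    simp [etaFun, Complex.ext_iff]
    constructor <;> linarith

lemma lam_perm_swapEnds (σ : Equiv.Perm (Fin 3)) :
    (baseConf.perm (swapEnds * σ)).lam = (baseConf.perm σ).lam := by
  rw [← Conf.perm_perm, ← act_halfTurn_base, ← act_perm]
  exact ((small_eta 0).perm σ).lam_twist _

/-- The strip depends only on the slot `σ⁻¹ 1` occupied by the middle point, because exchanging the
two ends is a half turn and leaves the ratio fixed. -/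
lemma lam_base_re (σ : Equiv.Perm (Fin 3)) : ((baseConf.perm σ).lam.1.re ≠ 0 ∧
    (baseConf.perm σ).lam.1.re ≠ 1) ∧ strip (baseConf.perm σ).lam.1 = 1 - σ⁻¹ 1 := by
  obtain ⟨⟨h0, h1⟩, h2⟩ := lam_base
  have key : ∀ k : Fin 3, ((baseConf.perm (cyc ^ (k : ℕ))).lam.1.re ≠ 0 ∧
      (baseConf.perm (cyc ^ (k : ℕ))).lam.1.re ≠ 1) ∧
      strip (baseConf.perm (cyc ^ (k : ℕ))).lam.1 = k := by
    intro k
    fin_cases k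
    · change (baseConf.lam.1.re ≠ 0 ∧ baseConf.lam.1.re ≠ 1) ∧ strip baseConf.lam.1 = 0
      rw [h0]
      norm_num [strip]
    · change ((baseConf.perm cyc).lam.1.re ≠ 0 ∧ (baseConf.perm cyc).lam.1.re ≠ 1) ∧
        strip (baseConf.perm cyc).lam.1 = 1
      rw [h1]
      norm_num [strip]
    · change ((baseConf.perm (cyc ^ 2)).lam.1.re ≠ 0 ∧ (baseConf.perm (cyc ^ 2)).lam.1.re ≠ 1) ∧
        strip (baseConf.perm (cyc ^ 2)).lam.1 = 2
      rw [h2]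
      norm_num [strip]
  have hσ : ∀ σ : Equiv.Perm (Fin 3), σ = cyc ^ (((1 : Fin 3) - σ⁻¹ 1 : Fin 3) : ℕ) ∨
      σ = swapEnds * cyc ^ (((1 : Fin 3) - σ⁻¹ 1 : Fin 3) : ℕ) := by decide
  have e : (baseConf.perm σ).lam =
      (baseConf.perm (cyc ^ (((1 : Fin 3) - σ⁻¹ 1 : Fin 3) : ℕ))).lam := by
    rcases hσ σ with h | h
    · exact congrArg (fun τ => (baseConf.perm τ).lam) h
    · exact (congrArg (fun τ => (baseConf.perm τ).lam) h).trans (lam_perm_swapEnds _)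
  rw [e]
  exact key _

/-! ### The two generators -/

lemma exists_straighten : ∃ K : 𝕀 → bdryFix, ContFam (fun t => (K t).1) ∧
    (∀ t, IsDiffeo (K t).1) ∧ (∀ t (x : Disc), 3 / 4 ≤ ‖(x : ℂ)‖ → (K t).1 x = x) ∧
    (∀ t, act (K t) baseConf = eta t) ∧ K 0 = 1 := by
  have hN : Continuous fun q : 𝕀 × 𝕀 => eta (q.1 * q.2) := continuous_eta.comp (by fun_prop)
  -- With `R = 3 / 4` the support avoids the collar where the twists are damped; the points
  -- themselves stay within radius 1/2.
  obtain ⟨K, h1, h2, h3, h4, h5⟩ := exists_isotopy_extension hN (R := 3 / 4) (by norm_num)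
    (fun q i => (norm_etaFun_le (q.1 * q.2).2.1 (q.1 * q.2).2.2 i).trans_lt (by norm_num))
  refine ⟨fun t => ⟨K t, fun x hx => h3 t x (by rw [hx]; norm_num)⟩, h1, h2, h3, fun t => ?_, ?_⟩
  · have h := h4 t
    simp only [mul_zero, mul_one] at h
    exact Subtype.ext (funext h)
  · exact Subtype.ext (h5 0 fun t => by simp)

/-- An isotopy of diffeomorphisms carrying the base configuration along `eta`. -/
noncomputable def straighten : 𝕀 → bdryFix := exists_straighten.choose

lemma contFam_straighten : ContFam fun t => (straighten t).1 := exists_straighten.choose_spec.1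
lemma isDiffeo_straighten (t : 𝕀) : IsDiffeo (straighten t).1 :=
  exists_straighten.choose_spec.2.1 t
lemma straighten_apply_of_ge (t : 𝕀) {x : Disc} (hx : 3 / 4 ≤ ‖(x : ℂ)‖) :
    (straighten t).1 x = x := exists_straighten.choose_spec.2.2.1 t x hx
lemma act_straighten (t : 𝕀) : act (straighten t) baseConf = eta t :=
  exists_straighten.choose_spec.2.2.2.1 t
lemma straighten_zero : straighten 0 = 1 := exists_straighten.choose_spec.2.2.2.2

/-- The half turn. -/
noncomputable def halfTurn : bdryFix := twist Real.pi

/-- The third of a turn, conjugated to preserve the base configuration. -/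
noncomputable def thirdTurn : bdryFix :=
  (straighten 1)⁻¹ * (twist (2 * Real.pi / 3) * straighten 1)

lemma isDiffeo_halfTurn : IsDiffeo halfTurn.1 := isDiffeo_twist _

lemma isDiffeo_thirdTurn : IsDiffeo thirdTurn.1 :=
  (isDiffeo_straighten 1).inv.mul ((isDiffeo_twist _).mul (isDiffeo_straighten 1))

/-- The supports are disjoint: the full twist moves only points of norm above 3/4, and `straighten`
only points of norm below 3/4. -/
lemma commute_straighten : Commute (twist (2 * Real.pi)) (straighten 1) := by
  refine alex_ext fun x => ?_
  change (twist (2 * Real.pi)).1 ((straighten 1).1 x) = (straighten 1).1 ((twist _).1 x)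
  rcases le_total (3 / 4) ‖(x : ℂ)‖ with hx | hx
  · rw [straighten_apply_of_ge 1 hx, straighten_apply_of_ge]
    rwa [coe_twist, norm_twistFun]
  · rw [twist_two_pi_apply hx, twist_two_pi_apply]
    by_contra! h
    have h' := (straighten 1).1.injective (straighten_apply_of_ge 1 h.le)
    rw [h'] at h
    exact h.not_ge hx

lemma halfTurn_sq : halfTurn ^ 2 = twist (2 * Real.pi) := by
  rw [sq, halfTurn, ← twist_add]
  ring_nf

lemma thirdTurn_cube : thirdTurn ^ 3 = twist (2 * Real.pi) := by
  have h : twist (2 * Real.pi / 3) ^ 3 = twist (2 * Real.pi) := by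
    rw [pow_succ, sq, ← twist_add, ← twist_add]
    ring_nf
  rw [thirdTurn, ← mul_assoc]
  have := conj_pow (i := 3) (a := (straighten 1)⁻¹) (b := twist (2 * Real.pi / 3))
  rw [inv_inv] at this
  rw [this, h, mul_assoc, commute_straighten.eq, inv_mul_cancel_left]

lemma act_halfTurn (σ : Equiv.Perm (Fin 3)) :
    act halfTurn (baseConf.perm σ) = baseConf.perm (swapEnds * σ) := by
  rw [act_perm, halfTurn, act_halfTurn_base, Conf.perm_perm]

lemma act_thirdTurn (σ : Equiv.Perm (Fin 3)) :
    act thirdTurn (baseConf.perm σ) = baseConf.perm (cyc * σ) := by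
  rw [act_perm, thirdTurn, act_mul, act_mul, act_straighten, act_thirdTurn_triangle, act_perm,
    ← act_straighten 1, act_inv_act, Conf.perm_perm]

/-- The half turn does not move the ratio. -/
lemma pathAt_halfTurn (σ : Equiv.Perm (Fin 3)) :
    ∃ q : Path (baseConf.perm σ).lam (act halfTurn (baseConf.perm σ)).lam,
      ((pathAt halfTurn (baseConf.perm σ)).map Conf.continuous_lam).Homotopic q ∧
      ∀ t, q t = (baseConf.perm σ).lam :=
  ⟨(twistPath Real.pi (baseConf.perm σ)).map Conf.continuous_lam,
    (pathAt_twist _ _).map ⟨_, Conf.continuous_lam⟩,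
    fun _ => ((small_eta 0).perm σ).lam_twist _⟩

/-- The path of configurations traced by the third of a turn consists of positively oriented
triangles. -/
lemma exists_pathAt_thirdTurn : ∃ q : Path baseConf (act thirdTurn baseConf),
    (pathAt thirdTurn baseConf).Homotopic q ∧ ∀ t, 0 ≤ (q t).area := by
  set c := act (straighten 1) baseConf with hc
  set c' := act (twist (2 * Real.pi / 3)) c with hc'
  have hc'' : c' = c.perm cyc := by rw [hc', hc, act_straighten, act_thirdTurn_triangle]
  have hinv : ContFam fun t : 𝕀 => (straighten (unitInterval.symm t) * (straighten 1)⁻¹).1 :=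
    ContFam.mul (contFam_straighten.comp (by fun_prop)) (contFam_const _)
  let q1 : Path baseConf c :=
    { toFun := fun t => act (straighten t) baseConf
      continuous_toFun := continuous_act contFam_straighten continuous_id continuous_const
      source' := by rw [straighten_zero, act_one]
      target' := rfl }
  let q3 : Path c' (act (straighten 1)⁻¹ c') :=
    { toFun := fun t => act (straighten (unitInterval.symm t) * (straighten 1)⁻¹) c'
      continuous_toFun := continuous_act hinv continuous_id continuous_const
      source' := by simp
      target' := by simp [straighten_zero] }
  have e1 : (pathAt (straighten 1) baseConf).Homotopic q1 :=
    pathAt_homotopic_of_isotopy contFam_straighten straighten_zero rfl q1 (fun _ => rfl) rfl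
  have e2 : (pathAt (twist (2 * Real.pi / 3)) c).Homotopic (twistPath _ c) := pathAt_twist _ c
  have e3 : (pathAt (straighten 1)⁻¹ c').Homotopic q3 :=
    pathAt_homotopic_of_isotopy hinv (by simp) (by simp [straighten_zero]) q3 (fun _ => rfl) rfl
  -- The trace follows `eta` to the triangle, rotates it rigidly, and returns along `eta` relabelled
  -- by the even permutation `cyc`; the area is nonnegative on all three pieces.
  have e4 : (pathAt thirdTurn baseConf).Homotopic ((q1.trans (twistPath _ c)).trans q3) :=
    (pathAt_mul _ _ _).trans (((pathAt_mul _ _ _).trans (e1.hcomp e2)).hcomp e3)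
  have hpos : ∀ t, 0 ≤ (((q1.trans (twistPath (2 * Real.pi / 3) c)).trans q3) t).area := by
    intro t
    have ht := Set.mem_range_self (f := (q1.trans (twistPath (2 * Real.pi / 3) c)).trans q3) t
    rw [Path.trans_range, Path.trans_range] at ht
    rcases ht with (⟨s, hs⟩ | ⟨s, hs⟩) | ⟨s, hs⟩
    · rw [← hs]
      change 0 ≤ (act (straighten s) baseConf).area
      rw [act_straighten]
      exact area_eta_nonneg s
    · rw [← hs, Conf.area_nonneg_iff]
      change 0 ≤ (act (twist _) c).lam.1.im
      rw [hc, act_straighten, (small_eta 1).lam_twist, ← Conf.area_nonneg_iff]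
      exact area_eta_nonneg 1
    · rw [← hs]
      change 0 ≤ (act (straighten (unitInterval.symm s) * (straighten 1)⁻¹) c').area
      rw [hc'', act_perm, act_mul, hc, act_inv_act, act_straighten, Conf.area_perm,
        show isEven cyc = true by decide]
      simpa [halfSign] using area_eta_nonneg _
  exact ⟨_, e4, hpos⟩

/-- The ratio path of the third of a turn stays in a slit plane. -/
lemma pathAt_thirdTurn (σ : Equiv.Perm (Fin 3)) :
    ∃ q : Path (baseConf.perm σ).lam (act thirdTurn (baseConf.perm σ)).lam,
      ((pathAt thirdTurn (baseConf.perm σ)).map Conf.continuous_lam).Homotopic q ∧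
      ∀ t, (q t).1 ∈ slit (isEven σ) := by
  obtain ⟨q, hq, harea⟩ := exists_pathAt_thirdTurn
  exact ⟨(q.map (continuous_perm σ)).map Conf.continuous_lam,
    (hq.map ⟨_, continuous_perm σ⟩).map ⟨_, Conf.continuous_lam⟩,
    fun t => Conf.lam_perm_mem_slit (harea t) σ⟩

/-! ### The braid group on three strands -/

/-- The first standard generator of the braid group on three strands. -/
def braidS : BraidGroup 3 := PresentedGroup.of (0 : Fin 2)

/-- The second standard generator of the braid group on three strands. -/
def braidT : BraidGroup 3 := PresentedGroup.of (1 : Fin 2)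

lemma braid_relation : braidS * braidT * braidS = braidT * braidS * braidT := by
  have h : PresentedGroup.mk (braidRelators 3) _ = 1 :=
    PresentedGroup.one_of_mem (rels := braidRelators 3) (Or.inl ⟨(0 : Fin 2), (1 : Fin 2), rfl, rfl⟩)
  rw [map_mul, map_inv, mul_inv_eq_one] at h
  exact h

/-- The half twist. -/
def braidA : BraidGroup 3 := braidS * braidT * braidS

/-- The cyclic braid. -/
def braidB : BraidGroup 3 := braidS * braidT

lemma braidA_sq : braidA ^ 2 = braidB ^ 3 := by
  calc braidA ^ 2 = braidS * braidT * braidS * (braidS * braidT * braidS) := sq _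
    _ = braidS * braidT * braidS * (braidT * braidS * braidT) := by rw [braid_relation]
    _ = braidB ^ 3 := by simp only [braidB, pow_succ, pow_zero, one_mul, mul_assoc]

lemma braidS_eq : braidS = braidB⁻¹ * braidA := by
  rw [eq_inv_mul_iff_mul_eq]
  rfl

lemma braidT_eq : braidT = braidA * braidB⁻¹ := by
  rw [eq_mul_inv_iff_mul_eq, braidB, ← mul_assoc, ← braid_relation]
  rfl

section Lift
variable {H : Type*} [Group H] (a b : H)

/-- The images of the standard generators under `braidLift`. -/
def braidLiftGen : Fin 2 → H := ![b⁻¹ * a, a * b⁻¹]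

variable {a b}

/-- With `a ^ 2 = b ^ 3` both sides of the braid relation collapse to `a`. -/
lemma braidLift_rel (h : a ^ 2 = b ^ 3) :
    ∀ r ∈ braidRelators 3, FreeGroup.lift (braidLiftGen a b) r = 1 := by
  have key : b⁻¹ * a * (a * b⁻¹) * (b⁻¹ * a) = a * b⁻¹ * (b⁻¹ * a) * (a * b⁻¹) := by
    have h1 : b⁻¹ * a * (a * b⁻¹) * (b⁻¹ * a) = b⁻¹ * a ^ 2 * b⁻¹ * b⁻¹ * a := by
      simp only [sq, mul_assoc]
    have h2 : a * b⁻¹ * (b⁻¹ * a) * (a * b⁻¹) = a * b⁻¹ * b⁻¹ * a ^ 2 * b⁻¹ := by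
      simp only [sq, mul_assoc]
    rw [h1, h2, h]
    group
  rintro r (⟨i, j, hij, rfl⟩ | ⟨i, j, hij, rfl⟩)
  · have hi : i = (0 : Fin 2) := Fin.ext (by change (i : ℕ) = 0; have := j.2; omega)
    have hj : j = (1 : Fin 2) := Fin.ext (by
      change (j : ℕ) = 1
      rw [hi] at hij
      exact hij.symm)
    subst hi hj
    rw [map_mul, map_inv, mul_inv_eq_one]
    simp only [map_mul, FreeGroup.lift_apply_of]
    exact key
  · have := j.2
    omega

/-- The homomorphism from the braid group on three strands determined by two elements `a`, `b` with
`a ^ 2 = b ^ 3`. -/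
def braidLift (h : a ^ 2 = b ^ 3) : BraidGroup 3 →* H :=
  PresentedGroup.toGroup (braidLift_rel h)

lemma braidLift_S (h : a ^ 2 = b ^ 3) : braidLift h braidS = b⁻¹ * a :=
  PresentedGroup.toGroup.of (braidLift_rel h)

lemma braidLift_T (h : a ^ 2 = b ^ 3) : braidLift h braidT = a * b⁻¹ :=
  PresentedGroup.toGroup.of (braidLift_rel h)

lemma braidLift_B (h : a ^ 2 = b ^ 3) : braidLift h braidB = b := by
  rw [braidB, map_mul, braidLift_S, braidLift_T]
  calc b⁻¹ * a * (a * b⁻¹) = b⁻¹ * a ^ 2 * b⁻¹ := by simp only [sq, mul_assoc]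
    _ = b := by rw [h]; group

lemma braidLift_A (h : a ^ 2 = b ^ 3) : braidLift h braidA = a := by
  rw [show braidA = braidB * braidS from rfl, map_mul, braidLift_B, braidLift_S,
    mul_inv_cancel_left]

end Lift

/-- The standard generators are `braidB⁻¹ * braidA` and `braidA * braidB⁻¹`, so `braidA` and
`braidB` generate. -/
lemma braid_induction {p : BraidGroup 3 → Prop} (hA : p braidA) (hB : p braidB)
    (hmul : ∀ x y, p x → p y → p (x * y)) (hinv : ∀ x, p x → p x⁻¹) (x : BraidGroup 3) : p x := by
  let K : Subgroup (BraidGroup 3) :=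
    { carrier := {x | p x}
      mul_mem' := fun {x y} hx hy => hmul x y hx hy
      one_mem' := by
        have := hmul _ _ hA (hinv _ hA)
        rwa [mul_inv_cancel] at this
      inv_mem' := fun {x} hx => hinv x hx }
  have hS : braidS ∈ K := by
    rw [braidS_eq]
    exact K.mul_mem (K.inv_mem hB) hA
  have hT : braidT ∈ K := by
    rw [braidT_eq]
    exact K.mul_mem hA (K.inv_mem hB)
  refine PresentedGroup.generated_by (braidRelators 3) K (fun j => ?_) x
  have hj : j = (0 : Fin 2) ∨ j = (1 : Fin 2) := by
    change Fin 2 at j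
    fin_cases j <;> simp
  rcases hj with rfl | rfl
  · exact hS
  · exact hT

lemma braidA_sq_comm (x : BraidGroup 3) : Commute (braidA ^ 2) x := by
  refine braid_induction ?_ ?_ (fun _ _ hx hy => hx.mul_right hy) (fun _ hx => hx.inv_right) x
  · exact (Commute.refl _).pow_left 2
  · rw [braidA_sq]
    exact (Commute.refl _).pow_left 3

instance normal_zpowers_braidA_sq : (Subgroup.zpowers (braidA ^ 2)).Normal where
  conj_mem := by
    rintro n hn g
    obtain ⟨k, rfl⟩ := Subgroup.mem_zpowers_iff.1 hn
    have := ((braidA_sq_comm g).zpow_left k).eq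
    rw [← this, mul_inv_cancel_right]
    exact hn

/-! ### Realizing braids by diffeomorphisms -/

lemma exists_perm_of_homeoBdry {z : Fin 3 → ℂ} {c : Conf} (hc : ∀ i, z i = c.1 i)
    (f : homeoBdry z) : ∃ σ, act (toBdryFix z f) c = c.perm σ := by
  have h : ∀ i, ∃ j, c.1 j = f.1 (c.1 i) := fun i =>
    (mem_markedSet_iff hc).1 ((f.2.2 _).2 ((mem_markedSet_iff hc).2 ⟨i, rfl⟩))
  choose σ hσ using h
  have hinj : Function.Injective σ := fun i j hij =>
    c.2.1 (f.1.injective (by rw [← hσ, ← hσ, hij]))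
  exact ⟨Equiv.ofBijective σ (Finite.injective_iff_bijective.1 hinj),
    Subtype.ext (funext fun i => (hσ i).symm)⟩

lemma mem_homeoBdry_of_perm {z : Fin 3 → ℂ} {c : Conf} (hc : ∀ i, z i = c.1 i) {f : bdryFix}
    {σ : Equiv.Perm (Fin 3)} (h : act f c = c.perm σ) : f.1 ∈ homeoBdry z := by
  have h' : ∀ i, f.1 (c.1 i) = c.1 (σ i) := fun i => congrFun (congrArg Subtype.val h) i
  refine ⟨f.2, fun x => ?_⟩
  rw [mem_markedSet_iff hc, mem_markedSet_iff hc]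
  constructor
  · rintro ⟨i, hi⟩
    refine ⟨σ⁻¹ i, f.1.injective ?_⟩
    rw [h', ← hi]
    exact congrArg c.1 (σ.apply_symm_apply i)
  · rintro ⟨i, rfl⟩
    exact ⟨σ i, (h' i).symm⟩

/-- The points of the base configuration. -/
noncomputable def baseMark (i : Fin 3) : ℂ := baseConf.1 i

/-- The half turn as a diffeomorphism of the marked disc. -/
noncomputable def halfTurnDiff : diffBdry baseMark :=
  ⟨⟨halfTurn.1, mem_homeoBdry_of_perm (fun _ => rfl) (act_halfTurn 1)⟩, isDiffeo_halfTurn⟩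

/-- The third of a turn as a diffeomorphism of the marked disc. -/
noncomputable def thirdTurnDiff : diffBdry baseMark :=
  ⟨⟨thirdTurn.1, mem_homeoBdry_of_perm (fun _ => rfl) (act_thirdTurn 1)⟩, isDiffeo_thirdTurn⟩

/-- The relation holds as an equality of maps, not merely up to isotopy; this is the source of the
section. -/
lemma halfTurnDiff_sq : halfTurnDiff ^ 2 = thirdTurnDiff ^ 3 := by
  have h := congrArg Subtype.val (halfTurn_sq.trans thirdTurn_cube.symm)
  exact Subtype.ext (Subtype.ext h)

/-- The realization of braids by diffeomorphisms. -/
noncomputable def braidDiff : BraidGroup 3 →* diffBdry baseMark := braidLift halfTurnDiff_sq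

/-- The realization of braids by homeomorphisms fixing the boundary. -/
noncomputable def rep : BraidGroup 3 →* bdryFix :=
  ((toBdryFix baseMark).comp (diffBdry baseMark).subtype).comp braidDiff

lemma rep_A : rep braidA = halfTurn := by
  rw [rep, MonoidHom.comp_apply, braidDiff, braidLift_A]
  rfl

lemma rep_B : rep braidB = thirdTurn := by
  rw [rep, MonoidHom.comp_apply, braidDiff, braidLift_B]
  rfl

lemma exists_perm_rep (x : BraidGroup 3) : ∃ σ, act (rep x) baseConf = baseConf.perm σ :=
  exists_perm_of_homeoBdry (z := baseMark) (fun _ => rfl) (braidDiff x).1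

lemma twist_two_pi_mul_int (n : ℤ) : twist (2 * Real.pi * n) = twist (2 * Real.pi) ^ n := by
  let φ : Multiplicative ℝ →* bdryFix :=
    { toFun := fun θ => twist θ.toAdd
      map_one' := twist_zero
      map_mul' := fun θ θ' => twist_add _ _ }
  have := map_zpow φ (Multiplicative.ofAdd (2 * Real.pi)) n
  rw [← ofAdd_zsmul] at this
  simpa [φ, mul_comm] using this

lemma rep_A_sq_zpow (n : ℤ) : rep ((braidA ^ 2) ^ n) = twist (2 * Real.pi * n) := by
  rw [map_zpow, map_pow, rep_A, halfTurn_sq, twist_two_pi_mul_int]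

/-! ### Winding of the width -/

/-- The width, as a map to the punctured plane. -/
noncomputable def Conf.widthUnit (c : Conf) : {x : ℂ // x ≠ 0} := ⟨c.width, c.width_ne_zero⟩

/-- The path `p` has a continuous logarithm of the width with the given end values. -/
def HasLog {c c' : Conf} (p : Path c c') (u v : ℂ) : Prop :=
  ∃ ℓ : Path u v, ∀ t, Complex.exp (ℓ t) = (p t).width

lemma exists_hasLog {c c' : Conf} (p : Path c c') : ∃ v, HasLog p (Complex.log c.width) v := by
  let γ : C(𝕀, {x : ℂ // x ≠ 0}) :=
    ⟨fun t => (p t).widthUnit, (Conf.continuous_width.comp p.continuous).subtype_mk _⟩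
  obtain ⟨Γ, h1, h2⟩ := Complex.isCoveringMap_exp.exists_path_lifts γ (Complex.log c.width)
    (Subtype.ext (by
      change (p 0).width = Complex.exp (Complex.log c.width)
      rw [Complex.exp_log c.width_ne_zero, p.source]))
  exact ⟨Γ 1, ⟨Γ, h2, rfl⟩, fun t => congrArg Subtype.val (congrFun h1 t)⟩

lemma HasLog.trans {c c' c'' : Conf} {p : Path c c'} {q : Path c' c''} {u v w : ℂ}
    (hp : HasLog p u v) (hq : HasLog q v w) : HasLog (p.trans q) u w := by
  obtain ⟨ℓ, hℓ⟩ := hp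
  obtain ⟨ℓ', hℓ'⟩ := hq
  refine ⟨ℓ.trans ℓ', fun t => ?_⟩
  rw [Path.trans_apply, Path.trans_apply]
  split_ifs
  · exact hℓ _
  · exact hℓ' _

/-- Homotopy lifting for the covering `exp`: the end of the lifted width path is a homotopy
invariant. -/
lemma HasLog.congr {c c' : Conf} {p q : Path c c'} (h : p.Homotopic q) {u v : ℂ}
    (hp : HasLog p u v) : HasLog q u v := by
  obtain ⟨ℓ, hℓ⟩ := hp
  have hexp : ∀ r : Path c c', Complex.exp u = (r 0).width := fun r => by
    rw [r.source, ← p.source, ← hℓ 0, ℓ.source]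
  let W : Path c c' → C(𝕀, {x : ℂ // x ≠ 0}) := fun r =>
    ⟨fun t => (r t).widthUnit, (Conf.continuous_width.comp r.continuous).subtype_mk _⟩
  have h' : (W p).HomotopicRel (W q) {0, 1} :=
    h.map ⟨Conf.widthUnit, Conf.continuous_width.subtype_mk _⟩
  have hW : ∀ r, W r 0 = ⟨Complex.exp u, Complex.exp_ne_zero u⟩ := fun r =>
    Subtype.ext (hexp r).symm
  have cov := Complex.isCoveringMap_exp
  have key := cov.liftPath_apply_one_eq_of_homotopicRel h' u (hW p) (hW q)
  have e1 : ℓ.toContinuousMap = cov.liftPath (W p) u (hW p) := (cov.eq_liftPath_iff' (hW p)).2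
    ⟨funext fun t => Subtype.ext (hℓ t), ℓ.source⟩
  have hv : v = cov.liftPath (W q) u (hW q) 1 := by
    rw [← key, ← e1]
    exact ℓ.target.symm
  refine ⟨⟨cov.liftPath (W q) u (hW q), cov.liftPath_zero _ _ _, hv.symm⟩, fun t => ?_⟩
  exact congrArg Subtype.val (congrFun (cov.liftPath_lifts (W q) u (hW q)) t)

lemma HasLog.unique {c c' : Conf} {p : Path c c'} {u v v' : ℂ} (h : HasLog p u v)
    (h' : HasLog p u v') : v = v' := by
  obtain ⟨ℓ, hℓ⟩ := h
  obtain ⟨ℓ', hℓ'⟩ := h'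
  have := Complex.isCoveringMap_exp.eq_of_comp_eq ℓ.continuous ℓ'.continuous
    (funext fun t => Subtype.ext ((hℓ t).trans (hℓ' t).symm)) 0 (by simp)
  rw [← ℓ.target, ← ℓ'.target, this]

lemma hasLog_twistPath {c : Conf} (hc : c.Small) {u : ℂ} (hu : Complex.exp u = c.width) (θ : ℝ) :
    HasLog (twistPath θ c) u (u + θ * Complex.I) := by
  refine ⟨⟨⟨fun t => u + (θ * t : ℝ) * Complex.I, by fun_prop⟩, by simp, by simp⟩, fun t => ?_⟩
  change Complex.exp (u + (θ * t : ℝ) * Complex.I) = (act (twist (θ * t)) c).width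
  rw [hc.width_twist, Complex.exp_add, hu, mul_comm]

/-- The twist adds `2πin` to the logarithm of the width, while a constant path adds nothing. -/
lemma twist_two_pi_mul_int_ne {n : ℤ} {f : bdryFix} (hf : f = twist (2 * Real.pi * n))
    (h : ∃ r : Path baseConf (act f baseConf), (pathAt f baseConf).Homotopic r ∧
      ∀ t, r t = baseConf) : n = 0 := by
  subst hf
  obtain ⟨r, hr, hr'⟩ := h
  have hu := Complex.exp_log baseConf.width_ne_zero
  have h1 : HasLog r (Complex.log baseConf.width) (Complex.log baseConf.width) :=
    ⟨Path.refl _, fun t => by rw [hr' t]; exact hu⟩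
  have h2 := (hasLog_twistPath (small_eta 0) hu (2 * Real.pi * n)).congr (pathAt_twist _ _).symm
  have h3 := (h2.congr hr).unique h1
  have h4 : ((2 * Real.pi * n : ℝ) : ℂ) * Complex.I = 0 := by simpa using h3
  have h5 : (2 * Real.pi * n : ℝ) = 0 := by
    simpa [Complex.I_ne_zero] using h4
  have := Real.pi_pos
  have h6 : (n : ℝ) = 0 := by
    rcases mul_eq_zero.1 h5 with h | h
    · linarith
    · exact h
  exact_mod_cast h6

/-! ### The monodromy of a braid -/

lemma Path.Homotopic.map_trans {X Y : Type*} [TopologicalSpace X] [TopologicalSpace Y] {x y z : X}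
    {r : Path x z} {p : Path x y} {q : Path y z} (h : r.Homotopic (p.trans q)) {f : X → Y}
    (hf : Continuous f) : (r.map hf).Homotopic ((p.map hf).trans (q.map hf)) := by
  rw [← Path.map_trans]
  exact h.map ⟨f, hf⟩

section Monodromy
variable {G : Type*} [Group G]

variable (a b : G)

/-- The twisting of the covering with the symmetries of the half turn and of the third of a turn. -/
def braidTwist (k : Fin 3) : G := b ^ (k : ℕ) * a * b ^ (k : ℕ)

/-- The strip of the ratio of the base configuration reordered by `σ`. -/
def stripIdx (σ : Equiv.Perm (Fin 3)) : Fin 3 := 1 - σ⁻¹ 1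

/-- The gauge relating the monodromy of a braid to the braid. -/
def braidGauge (σ : Equiv.Perm (Fin 3)) : G :=
  (if isEven σ then 1 else a) * b ^ (stripIdx σ : ℕ)

variable {a b}

lemma stripIdx_swapEnds_mul : ∀ σ, stripIdx (swapEnds * σ) = stripIdx σ := by decide
lemma isEven_swapEnds_mul : ∀ σ, isEven (swapEnds * σ) = !isEven σ := by decide
lemma stripIdx_cyc_mul : ∀ σ, stripIdx (cyc * σ) =
    if isEven σ then stripIdx σ + 1 else stripIdx σ - 1 := by decide

lemma pow_val_add_one (hb : b ^ 3 = 1) (k : Fin 3) : b ^ ((k + 1 : Fin 3) : ℕ) = b * b ^ (k : ℕ) := by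
  fin_cases k
  · simp
  · simp [← sq]
  · simp [← pow_succ', hb]

lemma braidGauge_swapEnds (ha : a ^ 2 = 1) (σ : Equiv.Perm (Fin 3)) :
    braidGauge a b (swapEnds * σ) = a * braidGauge a b σ := by
  rw [braidGauge, braidGauge, stripIdx_swapEnds_mul, isEven_swapEnds_mul, ← mul_assoc]
  cases isEven σ <;> simp [← sq, ha]

variable [TopologicalSpace G] [DiscreteTopology G]

/-- The transport along the path of ratios traced by `f`. -/
noncomputable def confTransport (tw : Fin 3 → G) (f : bdryFix) (c : Conf) : G → G :=
  transport tw ((pathAt f c).map Conf.continuous_lam)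

lemma confTransport_mul (tw : Fin 3 → G) (f g : bdryFix) (c : Conf) (x : G) :
    confTransport tw (f * g) c x = confTransport tw f (act g c) (confTransport tw g c x) := by
  have h := (pathAt_mul f g c).map_trans Conf.continuous_lam
  exact (congrFun (transport_congr tw h) x).trans (transport_trans tw _ _ x)

lemma confTransport_of_const (tw : Fin 3 → G) {f : bdryFix} {c : Conf}
    (hc : c.lam.1.re ≠ 0 ∧ c.lam.1.re ≠ 1) {q : Path c.lam (act f c).lam}
    (h : ((pathAt f c).map Conf.continuous_lam).Homotopic q) (hq : ∀ t, q t = c.lam) (x : G) :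
    confTransport tw f c x = x := by
  have hs : ∀ t, (q t).1 ∈ slit true := fun t => by rw [hq t]; exact Or.inl hc
  have e := transport_of_slit tw hs (by simpa using hs 0) (by simpa using hs 1) x
  rw [confTransport, transport_congr tw h, e]
  simp [stripChange]

lemma confTransport_one (tw : Fin 3 → G) (c : Conf) (x : G) : confTransport tw 1 c x = x := by
  have h : ((pathAt 1 c).map Conf.continuous_lam).Homotopic (Path.refl c.lam) := by
    rw [pathAt_one]
    exact Path.Homotopic.refl _
  exact (congrFun (transport_congr tw h) x).trans (transport_refl tw _ x)

lemma confTransport_halfTurn (tw : Fin 3 → G) (ha : a ^ 2 = 1) (σ : Equiv.Perm (Fin 3)) (x : G) :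
    confTransport tw halfTurn (baseConf.perm σ) x =
      (braidGauge a b (swapEnds * σ))⁻¹ * a * braidGauge a b σ * x := by
  obtain ⟨q, hq, hconst⟩ := pathAt_halfTurn σ
  rw [confTransport_of_const tw (lam_base_re σ).1 hq hconst, braidGauge_swapEnds ha]
  group

/-- For even `σ` the path stays in the slit plane `true`, where transport is trivial, and the gauge
just gains a factor `b`. For odd `σ` it stays in `false` and the strip index drops from `k + 1` to
`k`. The transport is then `(b^k a b^k)⁻¹ (b^(k+1) a b^(k+1)) = (a b^k)⁻¹ b (a b^(k+1))`, which is
the reason for the shape of `braidTwist`. Indices wrap modulo 3 because `b ^ 3 = 1`. -/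
lemma confTransport_thirdTurn (hb : b ^ 3 = 1) (σ : Equiv.Perm (Fin 3)) (x : G) :
    confTransport (braidTwist a b) thirdTurn (baseConf.perm σ) x =
      (braidGauge a b (cyc * σ))⁻¹ * b * braidGauge a b σ * x := by
  obtain ⟨q, hq, hs⟩ := pathAt_thirdTurn σ
  have hlam : (act thirdTurn (baseConf.perm σ)).lam = (baseConf.perm (cyc * σ)).lam := by
    rw [act_thirdTurn]
  have hx := lam_base_re σ
  have hy := lam_base_re (cyc * σ)
  rw [← hlam] at hy
  have e := transport_of_slit (braidTwist a b) hs (Or.inl hx.1) (Or.inl hy.1) x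
  rw [confTransport, transport_congr _ hq, e]
  have hxs : strip (baseConf.perm σ).lam.1 = stripIdx σ := hx.2
  have hys : strip (act thirdTurn (baseConf.perm σ)).lam.1 = stripIdx (cyc * σ) := hy.2
  rw [braidGauge, braidGauge, isEven_cyc_mul, stripIdx_cyc_mul]
  rw [stripIdx_cyc_mul] at hys
  cases h : isEven σ
  · rw [h] at hys
    simp only [stripChange, hxs, hys, braidTwist, Bool.false_eq_true, if_false]
    obtain ⟨k, hk⟩ : ∃ k, stripIdx σ = k + 1 := ⟨stripIdx σ - 1, by rw [sub_add_cancel]⟩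
    rw [hk, add_sub_cancel_right, pow_val_add_one hb]
    have hw : b * b ^ (k : ℕ) = b ^ (k : ℕ) * b := (Commute.self_pow b _).eq
    generalize b ^ (k : ℕ) = w at hw
    have hw' : w⁻¹ * (b * w) = b := by rw [hw, inv_mul_cancel_left]
    calc (w * a * w)⁻¹ * (b * w * a * (b * w) * x)
        = w⁻¹ * a⁻¹ * (w⁻¹ * (b * w)) * a * (b * w) * x := by group
      _ = (a * w)⁻¹ * b * (a * (b * w)) * x := by rw [hw']; group
  · simp only [stripChange, if_true, pow_val_add_one hb]
    group

lemma act_perm_of_act {f : bdryFix} {τ : Equiv.Perm (Fin 3)}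
    (h : act f baseConf = baseConf.perm τ) (σ : Equiv.Perm (Fin 3)) :
    act f (baseConf.perm σ) = baseConf.perm (τ * σ) := by
  rw [act_perm, h, Conf.perm_perm]

/-- The monodromy of a braid computes its image in a group with `a ^ 2 = 1` and `b ^ 3 = 1`. -/
lemma confTransport_rep (ha : a ^ 2 = 1) (hb : b ^ 3 = 1) (ι : BraidGroup 3 →* G)
    (hιA : ι braidA = a) (hιB : ι braidB = b) (x : BraidGroup 3) :
    ∃ τ, act (rep x) baseConf = baseConf.perm τ ∧ ∀ σ g,
      confTransport (braidTwist a b) (rep x) (baseConf.perm σ) g =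
        (braidGauge a b (τ * σ))⁻¹ * ι x * braidGauge a b σ * g := by
  refine braid_induction (p := fun x => ∃ τ, act (rep x) baseConf = baseConf.perm τ ∧ ∀ σ g,
      confTransport (braidTwist a b) (rep x) (baseConf.perm σ) g =
        (braidGauge a b (τ * σ))⁻¹ * ι x * braidGauge a b σ * g) ?_ ?_ ?_ ?_ x
  · rw [rep_A, hιA]
    exact ⟨swapEnds, act_halfTurn 1, fun σ g => confTransport_halfTurn _ ha σ g⟩
  · rw [rep_B, hιB]
    exact ⟨cyc, act_thirdTurn 1, fun σ g => confTransport_thirdTurn hb σ g⟩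
  · rintro x y ⟨τ, hτ, hx⟩ ⟨τ', hτ', hy⟩
    refine ⟨τ * τ', ?_, fun σ g => ?_⟩
    · rw [map_mul, act_mul, hτ', act_perm_of_act hτ]
    · rw [map_mul, confTransport_mul, act_perm_of_act hτ', hy, hx, map_mul]
      simp only [mul_assoc, mul_inv_cancel_left]
  · rintro x ⟨τ, hτ, hx⟩
    have hinv : ∀ σ, act (rep x⁻¹) (baseConf.perm σ) = baseConf.perm (τ⁻¹ * σ) := by
      intro σ
      have : baseConf.perm σ = act (rep x) (baseConf.perm (τ⁻¹ * σ)) := by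
        rw [act_perm_of_act hτ, mul_inv_cancel_left]
      rw [this, map_inv, act_inv_act]
    refine ⟨τ⁻¹, ?_, fun σ g => ?_⟩
    · have := hinv 1
      rwa [mul_one] at this
    · have h1 := confTransport_mul (braidTwist a b) (rep x) (rep x⁻¹) (baseConf.perm σ) g
      rw [← map_mul, mul_inv_cancel, map_one, hinv, hx, mul_inv_cancel_left,
        confTransport_one] at h1
      rw [map_inv ι]
      generalize confTransport (braidTwist a b) (rep x⁻¹) (baseConf.perm σ) g = y at h1 ⊢
      subst h1
      simp [mul_assoc]

end Monodromy

/-- A braid whose diffeomorphism is isotopic to the identity is trivial. -/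
theorem eq_one_of_isotopic {x : BraidGroup 3} (h : Isotopic 1 (braidDiff x).1) : x = 1 := by
  obtain ⟨H, hH, h0, h1⟩ := h
  -- During the isotopy each marked point moves continuously in a finite, hence discrete, set, so it
  -- does not move.
  have hconst : ∀ t, act (toBdryFix baseMark (H t)) baseConf = baseConf := by
    intro t
    refine Subtype.ext (funext fun i => ?_)
    have hcont : Continuous fun s => (H s).1 (baseConf.1 i) :=
      ContFam.continuous_apply (h := fun s => (H s).1) hH continuous_id continuous_const
    have hfin : (Set.range baseConf.1).Finite := Set.finite_range _
    have key := isPreconnected_univ.constant_of_mapsTo hfin.isDiscrete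
      hcont.continuousOn (fun s _ => ?_) (Set.mem_univ t) (Set.mem_univ 0)
    · refine key.trans ?_
      rw [h0]
      rfl
    · obtain ⟨σ, hσ⟩ := exists_perm_of_homeoBdry (z := baseMark) (fun _ => rfl) (H s)
      exact ⟨σ i, (congrFun (congrArg Subtype.val hσ) i).symm⟩
  have hr : ∃ r : Path baseConf (act (rep x) baseConf), (pathAt (rep x) baseConf).Homotopic r ∧
      ∀ t, r t = baseConf := by
    have hend : baseConf = act (rep x) baseConf := by
      have := hconst 1
      rw [h1] at this
      exact this.symm
    exact ⟨_, pathAt_homotopic_of_isotopy (h := fun t => toBdryFix baseMark (H t)) hH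
      (by rw [h0]; rfl) (by rw [h1]; rfl) (Path.refl baseConf) (fun t => (hconst t).symm) hend,
      fun _ => rfl⟩
  -- Ratios cannot see the full twist, so the fibre of the covering is the quotient by it.
  let G := BraidGroup 3 ⧸ Subgroup.zpowers (braidA ^ 2)
  let ι : BraidGroup 3 →* G := QuotientGroup.mk' _
  let _ : TopologicalSpace G := ⊥
  have : DiscreteTopology G := ⟨rfl⟩
  have hker : ∀ y, ι y = 1 ↔ y ∈ Subgroup.zpowers (braidA ^ 2) := fun y =>
    QuotientGroup.eq_one_iff y
  have ha : ι braidA ^ 2 = 1 := by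
    rw [← map_pow, hker]
    exact Subgroup.mem_zpowers _
  have hb : ι braidB ^ 3 = 1 := by
    rw [← map_pow, hker, ← braidA_sq]
    exact Subgroup.mem_zpowers _
  obtain ⟨τ, hτ, hmono⟩ := confTransport_rep ha hb ι rfl rfl x
  obtain ⟨r, hr1, hr2⟩ := hr
  have e1 := hmono 1 1
  have e2 : confTransport (braidTwist (ι braidA) (ι braidB)) (rep x) baseConf 1 = 1 :=
    confTransport_of_const _ (lam_base_re 1).1 (hr1.map ⟨_, Conf.continuous_lam⟩)
      (fun t => congrArg Conf.lam (hr2 t)) 1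
  have hτ1 : τ = 1 := by
    have : baseConf.perm τ = baseConf := hτ.symm.trans (r.target.symm.trans (hr2 1))
    have h' : ∀ i, baseConf.1 (τ i) = baseConf.1 i := fun i =>
      congrFun (congrArg Subtype.val this) i
    exact Equiv.ext fun i => baseConf.2.1 (h' i)
  subst hτ1
  have hgauge : braidGauge (ι braidA) (ι braidB) 1 = 1 := by
    rw [braidGauge, show isEven 1 = true by decide, show stripIdx 1 = 0 by decide]
    simp
  have e3 : ι x = 1 := by
    have := e1.symm.trans e2
    simpa [hgauge] using this
  -- What the ratio leaves undetermined is a power of the full twist, which the winding of the width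
  -- detects.
  obtain ⟨n, hn⟩ := Subgroup.mem_zpowers_iff.1 ((hker x).1 e3)
  have : n = 0 := twist_two_pi_mul_int_ne (f := rep x) (by rw [← hn, rep_A_sq_zpow]) ⟨r, hr1, hr2⟩
  rw [← hn, this, zpow_zero]

/-! ### Paths of ratios realized by braids -/

/-- The path of ratios traced by the Alexander isotopy. -/
noncomputable def lamPath (f : bdryFix) (c : Conf) : Path c.lam (act f c).lam :=
  (pathAt f c).map Conf.continuous_lam

lemma lamPath_mul (f g : bdryFix) (c : Conf) :
    (lamPath (f * g) c).Homotopic ((lamPath g c).trans (lamPath f (act g c))) :=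
  (pathAt_mul f g c).map_trans Conf.continuous_lam

lemma forall_trans_mem {X : Type*} [TopologicalSpace X] {x y z : X} {p : Path x y} {q : Path y z}
    {s : Set X} (hp : ∀ t, p t ∈ s) (hq : ∀ t, q t ∈ s) (t : 𝕀) : p.trans q t ∈ s := by
  rw [Path.trans_apply]
  split_ifs
  · exact hp _
  · exact hq _

/-- A slit plane as a set of ratios. -/
def slitPunc (b : Bool) : Set Punc := {x | x.1 ∈ slit b}

/-- A braid moves `c` to `c'` with a path of ratios homotopic to a path in a slit plane. -/
def Reach (b : Bool) (c c' : Conf) : Prop :=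
  ∃ f ∈ rep.range, ∃ h : act f c = c', ∃ q : Path c.lam c'.lam,
    (lamPath f c).Homotopic (q.cast rfl (congrArg Conf.lam h)) ∧ ∀ t, q t ∈ slitPunc b

lemma Reach.trans {b : Bool} {c c' c'' : Conf} (h : Reach b c c') (h' : Reach b c' c'') :
    Reach b c c'' := by
  obtain ⟨f, hf, rfl, q, hq, hs⟩ := h
  obtain ⟨g, hg, rfl, q', hq', hs'⟩ := h'
  exact ⟨g * f, mul_mem hg hf, rfl, q.trans q', (lamPath_mul g f c).trans (hq.hcomp hq'),
    forall_trans_mem hs hs'⟩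

lemma reach_swapEnds (b : Bool) (σ : Equiv.Perm (Fin 3)) :
    Reach b (baseConf.perm σ) (baseConf.perm (swapEnds * σ)) := by
  obtain ⟨q, hq, hs⟩ := pathAt_halfTurn σ
  rw [← act_halfTurn]
  exact ⟨halfTurn, ⟨_, rep_A⟩, rfl, q, hq, fun t => by
    rw [hs t]
    exact Or.inl (lam_base_re σ).1⟩

lemma reach_cyc (σ : Equiv.Perm (Fin 3)) :
    Reach (isEven σ) (baseConf.perm σ) (baseConf.perm (cyc * σ)) := by
  obtain ⟨q, hq, hs⟩ := pathAt_thirdTurn σ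
  rw [← act_thirdTurn]
  exact ⟨thirdTurn, ⟨_, rep_B⟩, rfl, q, hq, hs⟩

lemma reach_of_isEven_eq {b : Bool} {σ σ' : Equiv.Perm (Fin 3)} (h : isEven σ = b)
    (h' : isEven σ' = b) : Reach b (baseConf.perm σ) (baseConf.perm σ') := by
  subst h
  have key : ∀ n : ℕ, Reach (isEven σ) (baseConf.perm σ) (baseConf.perm (cyc ^ (n + 1) * σ)) := by
    intro n
    induction n with
    | zero =>
      rw [zero_add, pow_one]
      exact reach_cyc σ
    | succ n ih =>
      have h := reach_cyc (cyc ^ (n + 1) * σ)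
      have heven : ∀ m : ℕ, isEven (cyc ^ m * σ) = isEven σ := by
        intro m
        induction m with
        | zero => rw [pow_zero, one_mul]
        | succ m ih => rw [pow_succ', mul_assoc, isEven_cyc_mul, ih]
      rw [heven, ← mul_assoc, ← pow_succ'] at h
      exact ih.trans h
  -- Exponents 1, 2, 3 cover a whole parity class; `cyc ^ 3 = 1` stands in for reflexivity of
  -- `Reach`.
  have hn : ∀ σ σ' : Equiv.Perm (Fin 3), isEven σ' = isEven σ →
      ∃ n : Fin 3, cyc ^ ((n : ℕ) + 1) * σ = σ' := by decide
  obtain ⟨n, rfl⟩ := hn σ σ' h'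
  exact key n

/-- Third turns connect the orders whose parity matches the slit plane. Half turns change parity
without moving the ratio, so they are allowed in either slit plane. -/
lemma reach (b : Bool) (σ σ' : Equiv.Perm (Fin 3)) :
    Reach b (baseConf.perm σ) (baseConf.perm σ') := by
  have hsrc : ∀ τ, isEven τ = b → Reach b (baseConf.perm σ) (baseConf.perm τ) := by
    intro τ hτ
    rcases Bool.eq_or_eq_not (isEven σ) b with h | h
    · exact reach_of_isEven_eq h hτ
    · exact (reach_swapEnds b σ).trans
        (reach_of_isEven_eq (by rw [isEven_swapEnds_mul, h, Bool.not_not]) hτ)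
  rcases Bool.eq_or_eq_not (isEven σ') b with h | h
  · exact hsrc _ h
  · have hs : swapEnds * (swapEnds * σ') = σ' := by
      rw [← mul_assoc, show swapEnds * swapEnds = 1 by decide, one_mul]
    have h2 := reach_swapEnds b (swapEnds * σ')
    rw [hs] at h2
    exact (hsrc _ (by rw [isEven_swapEnds_mul, h, Bool.not_not])).trans h2

/-- A path from the base ratio is homotopic to a path traced by a braid followed by a path in a slit
plane. -/
def NearBraid (b : Bool) {x y : Punc} (p : Path x y) : Prop :=
  ∃ h : baseConf.lam = x, ∃ f ∈ rep.range, ∃ δ : Path (act f baseConf).lam y,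
    (p.cast h rfl).Homotopic ((lamPath f baseConf).trans δ) ∧ ∀ t, δ t ∈ slitPunc b

lemma NearBraid.congr {b : Bool} {x y : Punc} {p q : Path x y} (hp : NearBraid b p)
    (h : p.Homotopic q) : NearBraid b q := by
  obtain ⟨rfl, f, hf, δ, h1, h2⟩ := hp
  exact ⟨rfl, f, hf, δ, h.symm.trans h1, h2⟩

lemma NearBraid.trans {b : Bool} {x y z : Punc} {p : Path x y} (hp : NearBraid b p) {ε : Path y z}
    (hε : ∀ t, ε t ∈ slitPunc b) : NearBraid b (p.trans ε) := by
  obtain ⟨rfl, f, hf, δ, h1, h2⟩ := hp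
  exact ⟨rfl, f, hf, δ.trans ε,
    (h1.hcomp (.refl ε)).trans ⟨Path.Homotopy.transAssoc _ _ _⟩, forall_trans_mem h2 hε⟩

lemma nearBraid_refl {b : Bool} {x : Punc} (h : baseConf.lam = x) :
    NearBraid b (Path.refl x) := by
  subst h
  refine ⟨rfl, 1, one_mem _, Path.refl _, ?_, fun t => Or.inl (lam_base_re 1).1⟩
  have e : lamPath 1 baseConf = Path.refl _ := by
    rw [lamPath, pathAt_one]
    rfl
  rw [e]
  exact ⟨(Path.Homotopy.transRefl _).symm⟩

/-- A path near a braid is homotopic to a braid with prescribed permutation followed by a path in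
the slit plane. -/
lemma NearBraid.exists_perm {b : Bool} {x y : Punc} {p : Path x y} (hp : NearBraid b p)
    (σ : Equiv.Perm (Fin 3)) {κ : Path (baseConf.perm σ).lam y} (hκ : ∀ t, κ t ∈ slitPunc b) :
    ∃ h : baseConf.lam = x, ∃ f ∈ rep.range, ∃ h' : act f baseConf = baseConf.perm σ,
      (p.cast h rfl).Homotopic
        ((lamPath f baseConf).trans (κ.cast (congrArg Conf.lam h') rfl)) := by
  obtain ⟨rfl, f, ⟨w, rfl⟩, δ, h1, h2⟩ := hp
  obtain ⟨τ, hτ⟩ := exists_perm_rep w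
  obtain ⟨g, hg, h', q, hq, hs⟩ : Reach b (act (rep w) baseConf) (baseConf.perm σ) := by
    rw [hτ]
    exact reach b τ σ
  refine ⟨rfl, g * rep w, mul_mem hg ⟨w, rfl⟩, h', ?_⟩
  generalize baseConf.perm σ = c at *
  subst h'
  -- Both paths lie in the same simply connected slit plane.
  have e1 : δ.Homotopic (q.trans κ) := homotopic_of_slit h2 (forall_trans_mem hs hκ)
  have e2 : δ.Homotopic ((lamPath g (act (rep w) baseConf)).trans κ) :=
    e1.trans (hq.symm.hcomp (.refl κ))
  exact (h1.trans ((Path.Homotopic.refl _).hcomp e2)).trans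
    ((Path.Homotopic.symm ⟨Path.Homotopy.transAssoc _ _ _⟩).trans
      ((lamPath_mul g (rep w) baseConf).symm.hcomp (.refl κ)))

/-- The endpoint lies in a strip. After adjusting the braid, the tail can start at a base ratio in
that strip and stay inside it, hence in both slit planes. -/
lemma NearBraid.switch {b : Bool} {x y : Punc} {p : Path x y} (hp : NearBraid b p)
    (hy : y ∈ slitPunc (!b)) : NearBraid (!b) p := by
  have hyb : y ∈ slitPunc b := by
    obtain ⟨-, f, -, δ, -, h⟩ := hp
    simpa using h 1
  have hre := re_ne_of_mem_slit_inter hyb hy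
  have hσ : ∀ k : Fin 3, ∃ σ : Equiv.Perm (Fin 3), 1 - σ⁻¹ 1 = k := by decide
  obtain ⟨σ, hσ⟩ := hσ (strip y.1)
  obtain ⟨κ, hκ⟩ := exists_path_strip (lam_base_re σ).1 hre ((lam_base_re σ).2.trans hσ)
  obtain ⟨rfl, f, hf, h', h1⟩ := hp.exists_perm σ (κ := κ) fun t => Or.inl (hκ t)
  exact ⟨rfl, f, hf, _, h1, fun t => Or.inl (hκ t)⟩

/-- Every path from the base ratio is near a braid. -/
lemma exists_nearBraid {x y : Punc} (hx : baseConf.lam = x) (p : Path x y) :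
    ∃ b, NearBraid b p := by
  have hopen : ∀ b, IsOpen {t | p t ∈ slitPunc b} := fun b =>
    (isOpen_slit b).preimage (continuous_subtype_val.comp p.continuous)
  -- A Lebesgue subdivision: each piece of the path lies in one slit plane, and `switch` changes
  -- plane between pieces.
  obtain ⟨t, ht0, hmono, ⟨n, hn⟩, hcov⟩ := exists_monotone_Icc_subset_open_cover_unitInterval
    hopen (fun s _ => Set.mem_iUnion.2 (mem_slit_union (p s).2.1 (p s).2.2))
  have key : ∀ n, ∃ b, NearBraid b (p.subpath 0 (t n)) := by
    intro n
    induction n with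
    | zero =>
      rw [ht0, Path.subpath_self]
      exact ⟨true, nearBraid_refl (by rw [p.source, hx])⟩
    | succ n ih =>
      obtain ⟨b, hb⟩ := ih
      obtain ⟨b', hb'⟩ := hcov n
      have hε : ∀ s, p.subpath (t n) (t (n + 1)) s ∈ slitPunc b' := by
        intro s
        have h : p.subpath (t n) (t (n + 1)) s ∈ Set.range (p.subpath (t n) (t (n + 1))) :=
          Set.mem_range_self s
        rw [Path.range_subpath_of_le _ _ _ (hmono n.le_succ)] at h
        obtain ⟨u, hu, hu'⟩ := h
        rw [← hu']
        exact hb' hu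
      have hnear : NearBraid b' (p.subpath 0 (t n)) := by
        rcases Bool.eq_or_eq_not b' b with rfl | rfl
        · exact hb
        · exact hb.switch (by simpa using hε 0)
      exact ⟨b', (hnear.trans hε).congr ⟨Path.Homotopy.subpathTransSubpath _ _ _ _⟩⟩
  obtain ⟨b, hb⟩ := key n
  rw [hn n le_rfl, Path.subpath_zero_one] at hb
  have : ∀ {x' y'} (hx : x' = x) (hy : y' = y), NearBraid b (p.cast hx hy) → NearBraid b p := by
    rintro _ _ rfl rfl h
    exact h
  exact ⟨b, this _ _ hb⟩

lemma homotopic_trans_of_const {X : Type*} [TopologicalSpace X] {x y z : X} (p : Path x y)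
    {q : Path y z} (hq : ∀ t, q t = y) (h : z = y) : (p.trans q).Homotopic (p.cast rfl h) := by
  subst h
  obtain rfl : q = Path.refl _ := Path.ext (funext hq)
  exact ⟨Path.Homotopy.transRefl p⟩

/-- Every homeomorphism of the marked disc traces the same ratios as a braid, up to homotopy. -/
lemma exists_lamPath_homotopic (f : bdryFix) {σ : Equiv.Perm (Fin 3)}
    (hf : act f baseConf = baseConf.perm σ) :
    ∃ w, ∃ h : act f baseConf = act (rep w) baseConf,
      (lamPath f baseConf).Homotopic ((lamPath (rep w) baseConf).cast rfl
        (congrArg Conf.lam h)) := by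
  obtain ⟨b, hb⟩ := exists_nearBraid rfl (lamPath f baseConf)
  -- The endpoint is itself a base ratio, so the tail can be taken constant.
  obtain ⟨_, _, ⟨w, rfl⟩, h', h1⟩ := hb.exists_perm σ
    (κ := (Path.refl _).cast rfl (congrArg Conf.lam hf)) fun t => Or.inl (lam_base_re σ).1
  refine ⟨w, hf.trans h'.symm, Path.Homotopic.trans h1 ?_⟩
  exact homotopic_trans_of_const _ (fun _ => (congrArg Conf.lam h').symm) _

/-- Composing with full twists only changes the winding of the width. -/
lemma lamPath_twist_mul {g : bdryFix} {c : Conf} (hs : (act g c).Small) (n : ℤ) :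
    ∃ h : act (twist (2 * Real.pi * n) * g) c = act g c,
      (lamPath (twist (2 * Real.pi * n) * g) c).Homotopic
        ((lamPath g c).cast rfl (congrArg Conf.lam h)) ∧
      ∀ {u v}, HasLog (pathAt g c) u v → HasLog (pathAt (twist (2 * Real.pi * n) * g) c) u
        (v + (2 * Real.pi * n : ℝ) * Complex.I) := by
  have h : act (twist (2 * Real.pi * n)) (act g c) = act g c := by
    refine Conf.ext_coord fun i => ?_
    have : Complex.exp ((2 * Real.pi * n : ℝ) * Complex.I) = 1 := by
      rw [Complex.exp_eq_one_iff]
      exact ⟨n, by push_cast; ring⟩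
    rw [hs.coord_twist, this, one_mul]
  have e := (pathAt_mul (twist (2 * Real.pi * n)) g c).trans
    ((Path.Homotopic.refl _).hcomp (pathAt_twist (2 * Real.pi * n) (act g c)))
  refine ⟨h, (e.map_trans Conf.continuous_lam).trans
    (homotopic_trans_of_const _ (fun t => hs.lam_twist _) _), fun {u v} hv => ?_⟩
  have hw : Complex.exp v = (act g c).width := by
    obtain ⟨ℓ, hℓ⟩ := hv
    rw [← ℓ.target, hℓ, Path.target]
  exact (hv.trans (hasLog_twistPath hs hw _)).congr e.symm

/-- Every homeomorphism of the marked disc is isotopic to the diffeomorphism of a braid. -/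
theorem exists_isotopic_braidDiff (f : homeoBdry baseMark) :
    ∃ x, Isotopic f (braidDiff x).1 := by
  obtain ⟨σ, hσ⟩ := exists_perm_of_homeoBdry (z := baseMark) (fun _ => rfl) f
  obtain ⟨w, h, hw⟩ := exists_lamPath_homotopic (toBdryFix baseMark f) hσ
  obtain ⟨v, ℓ, hℓ⟩ := exists_hasLog (pathAt (toBdryFix baseMark f) baseConf)
  obtain ⟨v', hv'⟩ := exists_hasLog (pathAt (rep w) baseConf)
  have hexp : Complex.exp v = Complex.exp v' := by
    obtain ⟨ℓ', hℓ'⟩ := hv'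
    rw [← ℓ.target, ← ℓ'.target, hℓ, hℓ', Path.target, Path.target, h]
  -- Both logarithms end over the same width, so they differ by `2πin`; `n` full twists make up the
  -- difference.
  obtain ⟨n, hn⟩ := Complex.exp_eq_exp_iff_exists_int.1 hexp
  obtain ⟨τ, hτ⟩ := exists_perm_rep w
  obtain ⟨h', hlam, hlog⟩ := lamPath_twist_mul (g := rep w) (c := baseConf)
    (by rw [hτ]; exact (small_eta 0).perm τ) n
  obtain ⟨ℓ', hℓ'⟩ := hlog hv'
  have key : ∀ g, g = twist (2 * Real.pi * n) * rep w →
      ∀ hg : act (toBdryFix baseMark f) baseConf = act g baseConf,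
      (pathAt (toBdryFix baseMark f) baseConf).Homotopic ((pathAt g baseConf).cast rfl hg) := by
    rintro g rfl hg
    refine homotopic_of_lam _ _ (hw.trans ?_) ℓ ℓ' hℓ hℓ' (ℓ.source.trans ℓ'.source.symm)
      (ℓ.target.trans (Eq.trans ?_ ℓ'.target.symm))
    · exact (hlam.pathCast rfl (congrArg Conf.lam hg)).symm
    · rw [hn]
      push_cast
      ring
  have hrep : rep ((braidA ^ 2) ^ n * w) = twist (2 * Real.pi * n) * rep w := by
    rw [map_mul, rep_A_sq_zpow]
  have hg : act (toBdryFix baseMark f) baseConf = act (rep ((braidA ^ 2) ^ n * w)) baseConf :=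
    h.trans (h'.symm.trans (congrArg (act · baseConf) hrep.symm))
  exact ⟨(braidA ^ 2) ^ n * w, isotopic_of_homotopic (c := baseConf) (fun _ => rfl) f _ hg
    (key _ hrep hg)⟩

/-! ### Changing the marked points -/

/-- The configuration space is path connected. -/
lemma Conf.joined (c c' : Conf) : Joined c c' := by
  -- Linear interpolation with a complex parameter: each pair of points collides for at most one
  -- value, and the complement of a countable set in the plane is path connected, so a path from 0
  -- to 1 avoids all collisions.
  let y : ℂ → Fin 3 → ℂ := fun s i => c.coord i + s * (c'.coord i - c.coord i)
  let S : Set ℂ := {s | ¬ Function.Injective (y s)}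
  have hS : S.Countable := by
    have hsub : S ⊆ ⋃ (i : Fin 3) (j : Fin 3), {s | i ≠ j ∧ y s i = y s j} := by
      intro s hs
      simp only [S, Function.Injective, Set.mem_ofPred_eq, not_forall] at hs
      obtain ⟨i, j, hij, hne⟩ := hs
      exact Set.mem_iUnion₂.2 ⟨i, j, hne, hij⟩
    refine (Set.countable_iUnion fun i => Set.countable_iUnion fun j => ?_).mono hsub
    refine Set.Subsingleton.countable fun s hs s' hs' => ?_
    obtain ⟨hij, hs⟩ := hs
    have hs' := hs'.2
    simp only [y] at hs hs'
    by_contra hne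
    have h1 : (s - s') * ((c'.coord i - c.coord i) - (c'.coord j - c.coord j)) = 0 := by
      linear_combination hs - hs'
    have h2 := (mul_eq_zero.1 h1).resolve_left (sub_ne_zero.2 hne)
    exact hij (c.coord_injective (by linear_combination hs - s * h2))
  have hrank : 1 < Module.rank ℝ ℂ := by
    rw [Complex.rank_real_complex]
    exact Cardinal.one_lt_two
  have h0 : (0 : ℂ) ∈ Sᶜ := fun h => h fun i j hij => c.coord_injective (by simpa [y] using hij)
  have h1 : (1 : ℂ) ∈ Sᶜ := fun h => h fun i j hij => c'.coord_injective (by simpa [y] using hij)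
  obtain ⟨γ, hγ⟩ := (hS.isPathConnected_compl_of_one_lt_rank hrank).joinedIn 0 h0 1 h1
  have hinj : ∀ t, Function.Injective (y (γ t)) := fun t => not_not.1 (hγ t)
  refine ⟨⟨⟨fun t => Conf.ofCoord (y (γ t)) (hinj t), Conf.continuous_ofCoord hinj ?_⟩, ?_, ?_⟩⟩
  · fun_prop
  · exact Conf.ext_coord fun i => by simp [y]
  · exact Conf.ext_coord fun i => by simp [y]

lemma exists_isDiffeo_act_eq (c c' : Conf) : ∃ ψ : bdryFix, IsDiffeo ψ.1 ∧ act ψ c = c' := by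
  obtain ⟨p⟩ := c.joined c'
  obtain ⟨K, -, h2, h3, h4, -⟩ := exists_isotopy_extension
    (N := fun q : Unit × 𝕀 => p q.2) (by fun_prop) le_rfl (fun q i => (p q.2).2.2 i)
  refine ⟨⟨K (), fun x hx => h3 () x hx.ge⟩, h2 (), Subtype.ext (funext fun i => ?_)⟩
  have h := h4 () i
  simp only [p.source, p.target] at h
  exact h

section Conj
variable {m : ℕ} {z z' : Fin m → ℂ}

lemma toBdryFix_injective : Function.Injective (toBdryFix z) := fun f g h =>
  Subtype.ext (show (toBdryFix z f).1 = (toBdryFix z g).1 by rw [h])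

/-- Conjugation by a homeomorphism carrying the marked points `z` to `z'`. -/
noncomputable def conjHom (ψ : bdryFix) (h : ∀ x, ψ.1 x ∈ markedSet z' ↔ x ∈ markedSet z) :
    homeoBdry z →* homeoBdry z' where
  toFun f := ⟨(ψ * toBdryFix z f * ψ⁻¹).1, (ψ * toBdryFix z f * ψ⁻¹).2, fun x => by
    have e : ψ.1 (ψ.1.symm x) = x := ψ.1.apply_symm_apply x
    have h1 := (h (f.1 (ψ.1.symm x))).trans ((f.2.2 _).trans (h (ψ.1.symm x)).symm)
    rw [e] at h1
    exact h1⟩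
  map_one' := toBdryFix_injective (show ψ * 1 * ψ⁻¹ = 1 by group)
  map_mul' f g := toBdryFix_injective
    (show ψ * (toBdryFix z f * toBdryFix z g) * ψ⁻¹ =
      ψ * toBdryFix z f * ψ⁻¹ * (ψ * toBdryFix z g * ψ⁻¹) by group)

variable {ψ : bdryFix} {h : ∀ x, ψ.1 x ∈ markedSet z' ↔ x ∈ markedSet z}

lemma Isotopic.conj {f g : homeoBdry z} (hfg : Isotopic f g) :
    Isotopic (conjHom ψ h f) (conjHom ψ h g) := by
  obtain ⟨H, hH, h0, h1⟩ := hfg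
  refine ⟨fun t => conjHom ψ h (H t), ?_, congrArg (conjHom ψ h) h0, congrArg (conjHom ψ h) h1⟩
  exact ψ.1.continuous.comp
    (hH.comp (continuous_fst.prodMk (ψ.1.symm.continuous.comp continuous_snd)))

lemma mem_markedSet_inv_iff (h : ∀ x, ψ.1 x ∈ markedSet z' ↔ x ∈ markedSet z) (x : Disc) :
    (ψ⁻¹).1 x ∈ markedSet z ↔ x ∈ markedSet z' := by
  have e : ψ.1 ((ψ⁻¹).1 x) = x := ψ.1.apply_symm_apply x
  rw [← h, e]

lemma conjHom_inv_conjHom (f : homeoBdry z) :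
    conjHom ψ⁻¹ (mem_markedSet_inv_iff h) (conjHom ψ h f) = f :=
  toBdryFix_injective
    (show ψ⁻¹ * (ψ * toBdryFix z f * ψ⁻¹) * ψ⁻¹⁻¹ = toBdryFix z f by group)

lemma conjHom_conjHom_inv (f : homeoBdry z') :
    conjHom ψ h (conjHom ψ⁻¹ (mem_markedSet_inv_iff h) f) = f :=
  toBdryFix_injective
    (show ψ * (ψ⁻¹ * toBdryFix z' f * ψ⁻¹⁻¹) * ψ⁻¹ = toBdryFix z' f by group)

lemma conjHom_mem_diffBdry (hψ : IsDiffeo ψ.1) {f : homeoBdry z} (hf : f ∈ diffBdry z) :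
    conjHom ψ h f ∈ diffBdry z' :=
  (hψ.mul (show IsDiffeo f.1 from hf)).mul hψ.inv

end Conj

/-! ### Bijectivity for arbitrary marked points, and the conclusion -/

/-- Braids are realized by diffeomorphisms representing every mapping class exactly once. -/
theorem exists_bijective_braid (z : Fin 3 → ℂ) (hz : Function.Injective z)
    (hz_int : ∀ i, ‖z i‖ < 1) :
    ∃ r : BraidGroup 3 →* diffBdry z, Function.Bijective ((mappingClass z).comp r) := by
  let c : Conf := ⟨fun i => ⟨z i, mem_closedBall_zero_iff.2 (hz_int i).le⟩,
    fun i j h => hz (congrArg Subtype.val h), hz_int⟩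
  obtain ⟨ψ, hψ, hψc⟩ := exists_isDiffeo_act_eq baseConf c
  have hc : ∀ i, ψ.1 (baseConf.1 i) = c.1 i := fun i => congrFun (congrArg Subtype.val hψc) i
  have h : ∀ x, ψ.1 x ∈ markedSet z ↔ x ∈ markedSet baseMark := by
    intro x
    refine (mem_markedSet_iff (c := c) fun _ => rfl).trans (Iff.trans (exists_congr fun i => ?_)
      (mem_markedSet_iff (z := baseMark) (c := baseConf) fun _ => rfl).symm)
    rw [← hc]
    exact ψ.1.injective.eq_iff
  let r : BraidGroup 3 →* diffBdry z :=
    ((conjHom ψ h).comp ((diffBdry baseMark).subtype.comp braidDiff)).codRestrict (diffBdry z)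
      fun x => conjHom_mem_diffBdry (h := h) hψ (braidDiff x).2
  refine ⟨r, (injective_iff_map_eq_one _).2 fun x hx => ?_, fun f => ?_⟩
  · have h1 : Isotopic 1 (conjHom ψ h (braidDiff x).1) :=
      ((mappingClass_eq_iff (conjHom ψ h (braidDiff x).1) 1).1 hx).symm
    have h2 := h1.conj (ψ := ψ⁻¹) (h := mem_markedSet_inv_iff h)
    rw [conjHom_inv_conjHom, map_one] at h2
    exact eq_one_of_isotopic h2
  · obtain ⟨f, rfl⟩ := QuotientGroup.mk_surjective f
    obtain ⟨x, hx⟩ := exists_isotopic_braidDiff (conjHom ψ⁻¹ (mem_markedSet_inv_iff h) f)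
    have h1 := hx.conj (ψ := ψ) (h := h)
    rw [conjHom_conjHom_inv] at h1
    exact ⟨x, ((mappingClass_eq_iff _ _).2 h1).symm⟩

theorem theorem4p1 (z : Fin 3 → ℂ) (hz : Function.Injective z) (hz_int : ∀ i, ‖z i‖ < 1) :
    Function.Surjective (mappingClass z) ∧
    Nonempty (MappingClassGroup z ≃* BraidGroup 3) ∧
    ∃ s : MappingClassGroup z →* diffBdry z,
      (mappingClass z).comp s = MonoidHom.id (MappingClassGroup z) := by
  obtain ⟨r, hr⟩ := exists_bijective_braid z hz hz_int
  -- All three claims follow from this isomorphism, since it factors through diffeomorphisms.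
  let e := MulEquiv.ofBijective ((mappingClass z).comp r) hr
  refine ⟨fun f => ?_, ⟨e.symm⟩, r.comp e.symm.toMonoidHom,
    MonoidHom.ext fun f => e.apply_symm_apply f⟩
  obtain ⟨x, hx⟩ := hr.2 f
  exact ⟨r x, hx⟩
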